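/- Let $h_2>h_1>0$ be constants and let $q_1,q_2:\mathbb{R}\to\mathbb{R}$ satisfy, for $i=1,2$: $q_i\in C^1(\mathbb{R})$, $q_i'$ is absolutely continuous on every compact interval, $q_i''\in L^2(\mathbb{R})$, and $\int_{\mathbb{R}}(1+|x|^3)\,|q_i^{(k)}(x)|\,dx<\infty$ for $k=0,1,2$. In the complex Hilbert space $\mathcal{H}=L^2(\mathbb{R})$ consider the selfadjoint operators $D_i=-\frac{d^2}{dx^2}+q_i+h_i$ with domain $H^2(\mathbb{R})$, and assume that there is $c_2>0$ with $(D_2u,u)\ge c_2\|u\|^2$ for all $u\in\mathrm{dom}(D_2)$. Let $L=D_2D_1$ with $\mathrm{dom}(L)=\{u\in\mathrm{dom}(D_1)\mid D_1u\in\mathrm{dom}(D_2)\}$, and let $L^*$ be its adjoint. Let $D_2^{1/2}$ be the positive square root of $D_2$, which maps its domain onto $\mathcal{H}$, and let $E_\Lambda$ be the resolution of the identity of the selfadjoint operator $\Lambda=D_2^{1/2}D_1D_2^{1/2}$ (on its natural domain). Then there is a bounded, strongly countably additive projection valued measure $E_L$ on the Borel subsets of $\mathbb{R}$, with $E_L(b)=D_2^{1/2}E_\Lambda(b)D_2^{-1/2}$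 for every bounded Borel set $b$, such that for every ascending sequence $(b_n)$ of bounded Borel subsets of $\mathbb{R}$ with $\sigma(L)\subseteq\bigcup_n b_n$ and every $f\in\mathrm{dom}(L)$, $$Lf=\lim_{n\to\infty}\int_{b_n}\lambda\,E_L(d\lambda)\,f .$$ Moreover $L$ is an unbounded spectral operator of scalar type in the sense of Dunford and Bade, with resolution of the identity $b\mapsto E_L(b\cap\mathbb{R})$ for Borel sets $b\subseteq\mathbb{C}$. The same two statements hold for $L^*$ in place of $L$, with $E_{L^*}(b)=E_L(b)^*$ in place of $E_L(b)$. Here a densely defined closed operator $T$ in $\mathcal{H}$ is an unbounded spectral operator of scalar type, with resolution of the identity $E$, if $E$ is a bounded, strongly countably additive projection valued measure on the Borel subsets of $\mathbb{C}$ with $E(\mathbb{C})=E(\sigma(T))=I$ such that: $\mathrm{ran}\,E(b)\subseteq\mathrm{dom}(T)$ for bounded $b$; $E(b)\,\mathrm{dom}(T)\subseteq\mathrm{dom}(T)$ and $TE(b)f=E(b)Tf$ for $f\in\mathrm{dom}(T)$; the spectrum of the restriction of $T$ to $\mathrm{ran}\,E(b)$ is contained in $\overline{b}$; and $\mathrm{dom}(T)$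 is the set of $f$ for which $\lim_n\int_{|z|\le n}z\,E(dz)f$ exists, the limit being $Tf$. The integral of a bounded Borel function with respect to $E$ is the limit in operator norm of the integrals of simple functions converging to it uniformly. -/

import Mathlib

open MeasureTheory Filter Topology
open scoped InnerProductSpace LinearPMap SchwartzMap

noncomputable section

namespace SpectralODE

/-! ### Unbounded operators: products, spectrum, restrictions -/

section Unbounded

variable {X Y Z : Type*} [NormedAddCommGroup X] [NormedSpace ℂ X]
  [NormedAddCommGroup Y] [NormedSpace ℂ Y] [NormedAddCommGroup Z] [NormedSpace ℂ Z]

/-- The product `B A` of two unbounded operators on its natural domain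
`{x ∈ dom A | A x ∈ dom B}`. -/
def prodOp (B : Y →ₗ.[ℂ] Z) (A : X →ₗ.[ℂ] Y) : X →ₗ.[ℂ] Z where
  domain :=
    { carrier := {x | ∃ h : x ∈ A.domain, A ⟨x, h⟩ ∈ B.domain}
      zero_mem' := ⟨A.domain.zero_mem, by
        have h : A ⟨0, A.domain.zero_mem⟩ = 0 := A.map_zero
        rw [h]; exact B.domain.zero_mem⟩
      add_mem' := by
        rintro x y ⟨hx, hx'⟩ ⟨hy, hy'⟩
        refine ⟨A.domain.add_mem hx hy, ?_⟩
        have h : A ⟨x + y, A.domain.add_mem hx hy⟩ = A ⟨x, hx⟩ + A ⟨y, hy⟩ :=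
          A.map_add ⟨x, hx⟩ ⟨y, hy⟩
        rw [h]; exact B.domain.add_mem hx' hy'
      smul_mem' := by
        rintro c x ⟨hx, hx'⟩
        refine ⟨A.domain.smul_mem c hx, ?_⟩
        have h : A ⟨c • x, A.domain.smul_mem c hx⟩ = c • A ⟨x, hx⟩ := A.map_smul c ⟨x, hx⟩
        rw [h]; exact B.domain.smul_mem c hx' }
  toFun :=
    { toFun := fun x => B ⟨A ⟨x, x.2.1⟩, x.2.2⟩
      map_add' := by
        rintro ⟨x, hx, hx'⟩ ⟨y, hy, hy'⟩
        rw [← B.map_add]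
        congr 1
        exact Subtype.ext (A.map_add ⟨x, hx⟩ ⟨y, hy⟩)
      map_smul' := by
        rintro c ⟨x, hx, hx'⟩
        rw [RingHom.id_apply, ← B.map_smul]
        congr 1
        exact Subtype.ext (A.map_smul c ⟨x, hx⟩) }

/-- The resolvent set of an unbounded operator: those `z` for which `T - z` is a bijection of
`dom T` onto `X` with bounded inverse `R`. -/
def resolventSet (T : X →ₗ.[ℂ] X) : Set ℂ :=
  {z | ∃ R : X →L[ℂ] X,
    (∀ x, ∃ h : R x ∈ T.domain, T ⟨R x, h⟩ - z • R x = x) ∧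
    ∀ u : T.domain, R (T u - z • (u : X)) = u}

/-- The spectrum of an unbounded operator. -/
def spectrumOp (T : X →ₗ.[ℂ] X) : Set ℂ := (resolventSet T)ᶜ

/-- The restriction of `T` to a subspace `M`, an operator in `M` with domain
`{u ∈ M ∩ dom T | T u ∈ M}`. -/
def restrictOp (T : X →ₗ.[ℂ] X) (M : Submodule ℂ X) : M →ₗ.[ℂ] M where
  domain :=
    { carrier := {u | ∃ h : (u : X) ∈ T.domain, T ⟨u, h⟩ ∈ M}
      zero_mem' := ⟨T.domain.zero_mem, by
        have h : T ⟨((0 : M) : X), T.domain.zero_mem⟩ = 0 := T.map_zero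
        rw [h]; exact M.zero_mem⟩
      add_mem' := by
        rintro x y ⟨hx, hx'⟩ ⟨hy, hy'⟩
        refine ⟨T.domain.add_mem hx hy, ?_⟩
        have h : T ⟨((x + y : M) : X), T.domain.add_mem hx hy⟩ = T ⟨x, hx⟩ + T ⟨y, hy⟩ :=
          T.map_add ⟨x, hx⟩ ⟨y, hy⟩
        rw [h]; exact M.add_mem hx' hy'
      smul_mem' := by
        rintro c x ⟨hx, hx'⟩
        refine ⟨T.domain.smul_mem c hx, ?_⟩
        have h : T ⟨((c • x : M) : X), T.domain.smul_mem c hx⟩ = c • T ⟨x, hx⟩ :=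
          T.map_smul c ⟨x, hx⟩
        rw [h]; exact M.smul_mem c hx' }
  toFun :=
    { toFun := fun u => ⟨T ⟨((u : M) : X), u.2.1⟩, u.2.2⟩
      map_add' := by
        rintro ⟨x, hx, hx'⟩ ⟨y, hy, hy'⟩
        exact Subtype.ext (T.map_add ⟨x, hx⟩ ⟨y, hy⟩)
      map_smul' := by
        rintro c ⟨x, hx, hx'⟩
        exact Subtype.ext (T.map_smul c ⟨x, hx⟩) }

end Unbounded

/-! ### Spectral measures and spectral operators of scalar type -/

section Spectral

variable {α : Type*} [MeasurableSpace α]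
  {H : Type*} [NormedAddCommGroup H] [NormedSpace ℂ H]

/-- `E` is a bounded, strongly countably additive, projection valued measure on the measurable
subsets of `α` (the values of `E` at other sets play no role). -/
structure IsSpectralMeasure (E : Set α → H →L[ℂ] H) : Prop where
  bounded : ∃ c : ℝ, ∀ b, MeasurableSet b → ‖E b‖ ≤ c
  empty : E ∅ = 0
  univ : E Set.univ = ContinuousLinearMap.id ℂ H
  inter : ∀ b d, MeasurableSet b → MeasurableSet d → E (b ∩ d) = E b ∘L E d
  union : ∀ b d, MeasurableSet b → MeasurableSet d → E (b ∪ d) = E b + E d - E b ∘L E d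
  iUnion : ∀ b : ℕ → Set α, (∀ i, MeasurableSet (b i)) → Pairwise (Function.onFun Disjoint b) →
    ∀ f : H, HasSum (fun i => E (b i) f) (E (⋃ i, b i) f)

/-- The integral over `b` of a simple function with respect to `E`. -/
def simpleIntegral (E : Set α → H →L[ℂ] H) (b : Set α) (s : SimpleFunc α ℂ) : H →L[ℂ] H :=
  ∑ c ∈ s.range, c • E (s ⁻¹' {c} ∩ b)

/-- `A = ∫_b φ(λ) E(dλ)`: the operator `A` is the limit in operator norm of the integrals of simple
functions which converge to `φ` uniformly on `b`. For a spectral measure `E` such an `A` is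
unique. -/
def HasSpectralIntegral (E : Set α → H →L[ℂ] H) (φ : α → ℂ) (b : Set α) (A : H →L[ℂ] H) : Prop :=
  ∃ s : ℕ → SimpleFunc α ℂ, TendstoUniformlyOn (fun n => ⇑(s n)) φ atTop b ∧
    Tendsto (fun n => simpleIntegral E b (s n)) atTop (𝓝 A)

/-- `T` is an unbounded spectral operator of scalar type in the sense of Dunford and Bade, with
resolution of the identity `E` (defined on the Borel sets of the complex plane). The last field
says that `T f = lim_n ∫_{|z| ≤ n} z E(dz) f`, where `dom T` consists of those `f` for which the
limit exists. -/
structure IsScalarSpectral (T : H →ₗ.[ℂ] H) (E : Set ℂ → H →L[ℂ] H) : Prop where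
  dense_domain : Dense (T.domain : Set H)
  closed : T.IsClosed
  spectralMeasure : IsSpectralMeasure E
  spectrum : E (spectrumOp T) = ContinuousLinearMap.id ℂ H
  range_subset : ∀ b, MeasurableSet b → Bornology.IsBounded b → ∀ f, E b f ∈ T.domain
  commute : ∀ b, MeasurableSet b → ∀ f : T.domain,
    ∃ h : E b f ∈ T.domain, T ⟨E b f, h⟩ = E b (T f)
  restrict_spectrum : ∀ b, MeasurableSet b →
    spectrumOp (restrictOp T (LinearMap.range (E b : H →ₗ[ℂ] H))) ⊆ closure b
  scalar : ∃ A : ℕ → H →L[ℂ] H,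
    (∀ n : ℕ, HasSpectralIntegral E (fun z => z) (Metric.closedBall 0 n) (A n)) ∧
    ∀ f g : H, (f, g) ∈ T.graph ↔ Tendsto (fun n => A n f) atTop (𝓝 g)

/-- A set function on the Borel sets of the line, as a set function on the Borel sets of the complex
plane that is concentrated on the real axis. -/
def onReals (E : Set ℝ → H →L[ℂ] H) (b : Set ℂ) : H →L[ℂ] H := E (Complex.ofReal ⁻¹' b)

end Spectral

/-! ### The differential operators -/

/-- The Hilbert space `L²(ℝ)` of complex functions. -/
abbrev L2 : Type := Lp ℂ 2 (volume : Measure ℝ)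

/-- The graph of the distributional derivative: pairs `(u, v)` in `L²` with `u' = v` as tempered
distributions. -/
def derivGraph : Submodule ℂ (L2 × L2) where
  carrier := {p | TemperedDistribution.derivCLM ℂ (Lp.toTemperedDistribution p.1) =
    Lp.toTemperedDistribution p.2}
  zero_mem' := by
    have h := (Lp.toTemperedDistributionCLM ℂ (volume : Measure ℝ) 2).map_zero
    simp only [Lp.toTemperedDistributionCLM_apply] at h
    simp [h]
  add_mem' := by
    intro a b ha hb
    have h := (Lp.toTemperedDistributionCLM ℂ (volume : Measure ℝ) 2).map_add
    simp only [Lp.toTemperedDistributionCLM_apply] at h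
    simp only [Set.mem_ofPred_eq] at ha hb
    simp [h, ha, hb]
  smul_mem' := by
    intro c a ha
    have h := (Lp.toTemperedDistributionCLM ℂ (volume : Measure ℝ) 2).map_smul c
    simp only [Lp.toTemperedDistributionCLM_apply] at h
    simp only [Set.mem_ofPred_eq] at ha
    simp [h, ha]

theorem derivGraph_snd_eq_zero (p : L2 × L2) (hp : p ∈ derivGraph) (h0 : p.1 = 0) : p.2 = 0 := by
  have hp' : TemperedDistribution.derivCLM ℂ (Lp.toTemperedDistribution p.1) =
    Lp.toTemperedDistribution p.2 := hp
  have h := (Lp.toTemperedDistributionCLM ℂ (volume : Measure ℝ) 2).map_zero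
  simp only [Lp.toTemperedDistributionCLM_apply] at h
  rw [h0, h, map_zero] at hp'
  have hk : p.2 ∈ (Lp.toTemperedDistributionCLM ℂ (volume : Measure ℝ) 2).ker := by
    simp [← hp']
  rw [Lp.ker_toTemperedDistributionCLM_eq_bot] at hk
  simpa using hk

/-- The derivative `D` in `L²(ℝ)`, with domain the Sobolev space `H¹(ℝ)`. By
`derivGraph_snd_eq_zero`, its graph is `derivGraph`. -/
def derivOp : L2 →ₗ.[ℂ] L2 := derivGraph.toLinearPMap

/-- Multiplication by a real function `V` in `L²(ℝ)`, on its maximal domain. -/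
def mulOp (V : ℝ → ℝ) : L2 →ₗ.[ℂ] L2 where
  domain :=
    { carrier := {u | MemLp (fun x => (V x : ℂ) * u x) 2 volume}
      zero_mem' := by
        refine (memLp_congr_ae ?_).mp (MemLp.zero (ε := ℂ))
        filter_upwards [Lp.coeFn_zero ℂ 2 (volume : Measure ℝ)]
        simp
      add_mem' := by
        intro u v hu hv
        refine (memLp_congr_ae ?_).mp (MemLp.add hu hv)
        filter_upwards [Lp.coeFn_add u v] with x hx
        simp only [hx, Pi.add_apply, mul_add]
      smul_mem' := by
        intro c u hu
        refine (memLp_congr_ae ?_).mp (MemLp.const_smul hu c)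
        filter_upwards [Lp.coeFn_smul c u] with x hx
        simp [hx]; ring }
  toFun :=
    { toFun := fun u => MemLp.toLp _ u.2
      map_add' := by
        rintro ⟨u, hu⟩ ⟨v, hv⟩
        rw [← MemLp.toLp_add]
        refine (MemLp.toLp_eq_toLp_iff _ _).mpr ?_
        filter_upwards [Lp.coeFn_add u v] with x hx
        change (V x : ℂ) * (u + v : L2) x = (V x : ℂ) * u x + (V x : ℂ) * v x
        rw [hx, Pi.add_apply, mul_add]
      map_smul' := by
        rintro c ⟨u, hu⟩
        rw [RingHom.id_apply, ← MemLp.toLp_const_smul]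
        refine (MemLp.toLp_eq_toLp_iff _ _).mpr ?_
        filter_upwards [Lp.coeFn_smul c u] with x hx
        simp [hx]; ring }

/-- The operator `-D² + q + h` in `L²(ℝ)`. Its domain is the set of `u ∈ H²(ℝ)` with
`(q + h) u ∈ L²(ℝ)`, that is, `H²(ℝ)` when `q` is bounded. -/
def schrodingerOp (h : ℝ) (q : ℝ → ℝ) : L2 →ₗ.[ℂ] L2 :=
  -(prodOp derivOp derivOp) + mulOp (fun x => q x + h)

/-- The class of potentials: `q ∈ C¹(ℝ)`, `q'` is absolutely continuous on compact intervals,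
`q'' ∈ L²(ℝ)`, and `∫ (1 + |x|³) |q⁽ᵏ⁾(x)| dx < ∞` for `k = 0, 1, 2`. -/
structure IsAdmissible (q : ℝ → ℝ) : Prop where
  contDiff : ContDiff ℝ 1 q
  absCont : ∀ a b : ℝ, AbsolutelyContinuousOnInterval (deriv q) a b
  memLp : MemLp (deriv (deriv q)) 2 volume
  integrable : ∀ k : ℕ, k ≤ 2 → Integrable (fun x => (1 + |x| ^ 3) * |iteratedDeriv k q x|) volume

/-- `S` is the positive selfadjoint square root of the operator `A`. -/
structure IsPositiveSqrt (S A : L2 →ₗ.[ℂ] L2) : Prop where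
  selfAdjoint : IsSelfAdjoint S
  nonneg : ∀ u : S.domain, 0 ≤ (⟪S u, (u : L2)⟫_ℂ).re
  sq : prodOp S S = A

/-- `E` is the resolution of the identity of the selfadjoint operator `A` (its values are
orthogonal projections). -/
structure IsSelfAdjointResolution (A : L2 →ₗ.[ℂ] L2) (E : Set ℝ → L2 →L[ℂ] L2) : Prop where
  selfAdjoint : IsSelfAdjoint A
  selfAdjoint_proj : ∀ b, MeasurableSet b → IsSelfAdjoint (E b)
  scalarSpectral : IsScalarSpectral A (onReals E)

/-- `T f = lim_n ∫_{b_n} λ E(dλ) f` for all `f ∈ dom T` and all ascending sequences `b_n` of bounded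
Borel sets of real numbers that cover the (real) spectrum of `T`. -/
def HasSpectralLimit (T : L2 →ₗ.[ℂ] L2) (E : Set ℝ → L2 →L[ℂ] L2) : Prop :=
  ∀ b : ℕ → Set ℝ, Monotone b → (∀ n, MeasurableSet (b n)) →
    (∀ n, Bornology.IsBounded (b n)) → Complex.ofReal ⁻¹' spectrumOp T ⊆ ⋃ n, b n →
    ∃ A : ℕ → L2 →L[ℂ] L2,
      (∀ n, HasSpectralIntegral E (fun x => (x : ℂ)) (b n) (A n)) ∧
      ∀ f : T.domain, Tendsto (fun n => A n f) atTop (𝓝 (T f))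

end SpectralODE

end

/-!
The operator `L = D₂ D₁` is similar, by a bounded operator with bounded inverse, to the selfadjoint
operator `Λ = D₂^(1/2) D₁ D₂^(1/2)`; the spectral theorem for `Λ` is carried over to `L` and `L*`.
Everything is expressed through bounded operators: an unbounded operator `T` is handled through its
resolvent `(T + t)⁻¹` at one real point `-t` (`IsResolventAt`), which determines its graph.

*The two resolvents.* Let `R = D₂^(-1/2)`, a bounded positive injective operator
(`exists_inverse_schrodingerOp`). Then `D₁ = D₂ + M`, where `M` is the multiplication by
`m = q₁ - q₂ + h₁ - h₂`. The form domain `ran R` of `D₂` is the Sobolev space `H¹`; since `m` is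
bounded with a bounded derivative, `M` maps it into itself, that is, `M R = R N` with a bounded
operator `N` (`exists_mulCLM_sqrt_eq`). Formally `(Λ + t)⁻¹` is then `B = R⁴ J⁻¹` with
`J = 1 + N R² + t R⁴`, and for large `t` the operator `J` is invertible, because `R² (1 + t R⁴)⁻¹`
is small (`exists_inverse_one_add_comp_add`). As `R N R² = M R³`, the operator `B` is selfadjoint.

*The similarity.* Since `J` and its inverse are bounded, `‖B x‖` and `‖R⁴ x‖` are comparable. By the
Heinz inequality, applied twice, `‖K x‖` and `‖R x‖` are comparable for `K = |B|^(1/4)`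
(`exists_norm_apply_le_of_pow_four`), so `R = K W` with a bounded `W` that has a bounded inverse
(`exists_equiv_of_norm_apply_le`). The definition of `L` gives `(f, g) ∈ L` if and only if
`(R f, R g) ∈ Λ`, that is, `B R (g + t f) = R f`. As `K` commutes with `B`, the factor `K` cancels
and `(L + t)⁻¹ = W⁻¹ B W` (`exists_calculus_prodOp`). The square root `S = R⁻¹` itself is unbounded,
but since `K` commutes with the spectral projections `EΛ b`, one has `R (W⁻¹ EΛ b W) = EΛ b R`, so
that `E b = W⁻¹ EΛ b W` agrees with `S (EΛ b) S⁻¹`.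

*The spectral theorem.* A representation of the continuous functions on a compact space extends to
the bounded Borel functions through its spectral measures (`isBorelCalculus_borelExt`). For the
spectrum of `B` and the change of variable `s = x⁻¹ - t` this gives a calculus on the real line
(`exists_isOperatorCalculus`). Such a calculus makes an operator spectral of scalar type
(`IsOperatorCalculus.isScalarSpectral`), and it passes to similar operators and to adjoints.
-/

noncomputable section

namespace SpectralODE

/-! ### Bounded measurable functions -/

section BoundedMeasurable

variable {α : Type*} [MeasurableSpace α]

/-- Bounded measurable complex functions, the domain of a Borel functional calculus. -/
def IsBddMeas (φ : α → ℂ) : Prop := Measurable φ ∧ ∃ c : ℝ, ∀ x, ‖φ x‖ ≤ c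

theorem IsBddMeas.add {φ ψ : α → ℂ} (hφ : IsBddMeas φ) (hψ : IsBddMeas ψ) :
    IsBddMeas (φ + ψ) := by
  obtain ⟨c, hc⟩ := hφ.2
  obtain ⟨d, hd⟩ := hψ.2
  exact ⟨hφ.1.add hψ.1, c + d, fun x => (norm_add_le _ _).trans (add_le_add (hc x) (hd x))⟩

theorem IsBddMeas.mul {φ ψ : α → ℂ} (hφ : IsBddMeas φ) (hψ : IsBddMeas ψ) :
    IsBddMeas (φ * ψ) := by
  obtain ⟨c, hc⟩ := hφ.2
  obtain ⟨d, hd⟩ := hψ.2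
  refine ⟨hφ.1.mul hψ.1, c * d, fun x => ?_⟩
  rw [Pi.mul_apply, norm_mul]
  exact mul_le_mul (hc x) (hd x) (norm_nonneg _) ((norm_nonneg _).trans (hc x))

theorem isBddMeas_const (z : ℂ) : IsBddMeas (fun _ : α => z) :=
  ⟨measurable_const, ‖z‖, fun _ => le_rfl⟩

theorem isBddMeas_one : IsBddMeas (1 : α → ℂ) := isBddMeas_const 1

theorem IsBddMeas.smul {φ : α → ℂ} (z : ℂ) (hφ : IsBddMeas φ) : IsBddMeas (z • φ) :=
  (isBddMeas_const z).mul hφ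

theorem IsBddMeas.neg {φ : α → ℂ} (hφ : IsBddMeas φ) : IsBddMeas (-φ) := by
  simpa using hφ.smul (-1)

theorem IsBddMeas.sub {φ ψ : α → ℂ} (hφ : IsBddMeas φ) (hψ : IsBddMeas ψ) :
    IsBddMeas (φ - ψ) := by
  simpa [sub_eq_add_neg] using hφ.add hψ.neg

theorem IsBddMeas.star {φ : α → ℂ} (hφ : IsBddMeas φ) : IsBddMeas (star φ) := by
  obtain ⟨c, hc⟩ := hφ.2
  exact ⟨continuous_star.measurable.comp hφ.1, c, fun x => by simpa using hc x⟩

theorem IsBddMeas.comp {β : Type*} [MeasurableSpace β] {φ : α → ℂ} (hφ : IsBddMeas φ)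
    {g : β → α} (hg : Measurable g) : IsBddMeas (φ ∘ g) := by
  obtain ⟨c, hc⟩ := hφ.2
  exact ⟨hφ.1.comp hg, c, fun x => hc _⟩

theorem isBddMeas_indicator_one {b : Set α} (hb : MeasurableSet b) :
    IsBddMeas (b.indicator (1 : α → ℂ)) := by
  refine ⟨measurable_one.indicator hb, 1, fun x => ?_⟩
  by_cases hx : x ∈ b <;> simp [hx]

theorem IsBddMeas.memLp {φ : α → ℂ} (hφ : IsBddMeas φ) (μ : Measure α) [IsFiniteMeasure μ] :
    MemLp φ 2 μ := by
  obtain ⟨c, hc⟩ := hφ.2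
  exact MemLp.of_bound hφ.1.aestronglyMeasurable c (Eventually.of_forall hc)

theorem tendsto_eLpNorm_two_of_dominated {μ : Measure α} [IsFiniteMeasure μ] {φ : ℕ → α → ℂ}
    {ψ : α → ℂ} {c : ℝ} (hφ : ∀ n, Measurable (φ n)) (hψ : Measurable ψ)
    (hc : ∀ n x, ‖φ n x‖ ≤ c) (hlim : ∀ x, Tendsto (fun n => φ n x) atTop (𝓝 (ψ x))) :
    Tendsto (fun n => eLpNorm (φ n - ψ) 2 μ) atTop (𝓝 0) := by
  have hψc : ∀ x, ‖ψ x‖ ≤ c := fun x =>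
    le_of_tendsto (hlim x).norm (Eventually.of_forall fun n => hc n x)
  have h2 : Tendsto (fun n => ∫⁻ x, ‖(φ n - ψ) x‖ₑ ^ (2 : ℝ) ∂μ) atTop (𝓝 (∫⁻ _, 0 ∂μ)) := by
    refine tendsto_lintegral_of_dominated_convergence (fun _ => (ENNReal.ofReal (c + c)) ^ (2 : ℝ))
      (fun n => (((hφ n).sub hψ).enorm.pow_const _)) (fun n => ?_) ?_ ?_
    · refine Eventually.of_forall fun x => ?_
      refine ENNReal.rpow_le_rpow ?_ (by norm_num)
      rw [← ofReal_norm]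
      exact ENNReal.ofReal_le_ofReal ((norm_sub_le _ _).trans (add_le_add (hc n x) (hψc x)))
    · rw [lintegral_const]
      exact ENNReal.mul_ne_top (by simp) (measure_ne_top _ _)
    · refine Eventually.of_forall fun x => ?_
      have h3 : Tendsto (fun n => ‖(φ n - ψ) x‖ₑ) atTop (𝓝 0) := by
        have h4 : Tendsto (fun n => (φ n - ψ) x) atTop (𝓝 0) := by
          simpa using (hlim x).sub_const (ψ x)
        simpa using h4.enorm
      simpa [Function.comp_def] using
        (ENNReal.continuous_rpow_const (y := 2)).tendsto 0 |>.comp h3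
  have h5 : ∀ n, eLpNorm (φ n - ψ) 2 μ = (∫⁻ x, ‖(φ n - ψ) x‖ₑ ^ (2 : ℝ) ∂μ) ^ (1 / 2 : ℝ) := by
    intro n
    rw [eLpNorm_eq_lintegral_rpow_enorm_toReal (by norm_num) (by norm_num)]
    simp
  simp_rw [h5]
  have h6 := (ENNReal.continuous_rpow_const (y := (1 / 2 : ℝ))).tendsto (∫⁻ _, 0 ∂μ) |>.comp h2
  simpa [Function.comp_def] using h6

theorem isBddMeas_continuousMap {X : Type*} [TopologicalSpace X] [CompactSpace X]
    [MeasurableSpace X] [BorelSpace X] (f : C(X, ℂ)) : IsBddMeas f :=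
  ⟨f.continuous.measurable, ‖f‖, f.norm_coe_le_norm⟩

end BoundedMeasurable

/-! ### From continuous functions to Borel functions -/

section BorelExtension

open CompactlySupported

variable {X : Type*} [TopologicalSpace X]
  {H : Type*} [NormedAddCommGroup H] [InnerProductSpace ℂ H] [CompleteSpace H]

/-- A real continuous function as a complex one. -/
def toComplexMap (f : C(X, ℝ)) : C(X, ℂ) := ⟨fun x => (f x : ℂ), by fun_prop⟩

theorem inner_map_star_mul (Ψ : C(X, ℂ) →⋆ₐ[ℂ] (H →L[ℂ] H)) (f : C(X, ℂ)) (x : H) :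
    ⟪x, Ψ (star f * f) x⟫_ℂ = (‖Ψ f x‖ : ℂ) ^ 2 := by
  rw [map_mul, map_star, mul_apply_eq_comp, ContinuousLinearMap.star_eq_adjoint,
    ContinuousLinearMap.adjoint_inner_right, inner_self_eq_norm_sq_to_K]
  rfl

/-- The positive functional `f ↦ ⟪x, f x⟫` attached to a vector `x` and a representation of the
continuous functions. -/
def vecFunctional (Ψ : C(X, ℂ) →⋆ₐ[ℂ] (H →L[ℂ] H)) (x : H) : C_c(X, ℝ) →ₚ[ℝ] ℝ :=
  PositiveLinearMap.mk₀
    { toFun := fun f => (⟪x, Ψ (toComplexMap f.toContinuousMap) x⟫_ℂ).re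
      map_add' := by
        intro f g
        have : toComplexMap (f + g).toContinuousMap =
            toComplexMap f.toContinuousMap + toComplexMap g.toContinuousMap := by
          ext y; simp [toComplexMap]
        simp [this]
      map_smul' := by
        intro c f
        have : toComplexMap (c • f).toContinuousMap =
            (c : ℂ) • toComplexMap f.toContinuousMap := by
          ext y; simp [toComplexMap]
        rw [this, map_smul, smul_apply, inner_smul_right,
          Complex.re_ofReal_mul]
        rfl }
    (by
      intro f hf
      let g : C(X, ℂ) := ⟨fun y => (Real.sqrt (f y) : ℂ), by fun_prop⟩
      have : toComplexMap f.toContinuousMap = star g * g := by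
        ext y
        have h0 : 0 ≤ f y := hf y
        have h1 : ((Real.sqrt (f y) : ℝ) : ℂ) * (Real.sqrt (f y) : ℝ) = (f y : ℂ) := by
          rw [← Complex.ofReal_mul, Real.mul_self_sqrt h0]
        simp [toComplexMap, g, h1]
      change 0 ≤ (⟪x, Ψ (toComplexMap f.toContinuousMap) x⟫_ℂ).re
      rw [this, inner_map_star_mul, ← Complex.ofReal_pow, Complex.ofReal_re]
      positivity)

variable [CompactSpace X] [T2Space X] [MeasurableSpace X] [BorelSpace X]

/-- The spectral measure of a representation of the continuous functions at a vector `x`. -/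
def vecMeasure (Ψ : C(X, ℂ) →⋆ₐ[ℂ] (H →L[ℂ] H)) (x : H) : Measure X :=
  RealRMK.rieszMeasure (vecFunctional Ψ x)

instance (Ψ : C(X, ℂ) →⋆ₐ[ℂ] (H →L[ℂ] H)) (x : H) : IsFiniteMeasure (vecMeasure Ψ x) :=
  inferInstanceAs (IsFiniteMeasure (RealRMK.rieszMeasure _))

instance (Ψ : C(X, ℂ) →⋆ₐ[ℂ] (H →L[ℂ] H)) (x : H) : (vecMeasure Ψ x).Regular :=
  inferInstanceAs (RealRMK.rieszMeasure _).Regular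

theorem integral_vecMeasure (Ψ : C(X, ℂ) →⋆ₐ[ℂ] (H →L[ℂ] H)) (x : H) (f : C(X, ℝ)) :
    ∫ y, f y ∂(vecMeasure Ψ x) = (⟪x, Ψ (toComplexMap f) x⟫_ℂ).re :=
  RealRMK.integral_rieszMeasure (vecFunctional Ψ x)
    (CompactlySupportedContinuousMap.continuousMapEquiv f)

theorem norm_map_sq (Ψ : C(X, ℂ) →⋆ₐ[ℂ] (H →L[ℂ] H)) (x : H) (f : C(X, ℂ)) :
    ‖Ψ f x‖ ^ 2 = ∫ y, ‖f y‖ ^ 2 ∂(vecMeasure Ψ x) := by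
  have h := integral_vecMeasure Ψ x ⟨fun y => ‖f y‖ ^ 2, by fun_prop⟩
  have h1 : toComplexMap ⟨fun y => ‖f y‖ ^ 2, by fun_prop⟩ = star f * f := by
    ext y
    simp [toComplexMap, Complex.conj_mul']
  rw [h1, inner_map_star_mul, ← Complex.ofReal_pow, Complex.ofReal_re] at h
  exact h.symm

/-- The isometry `f x ↦ f` of the cyclic subspace of `x` into `L²` of its spectral measure. -/
theorem norm_map_eq_norm_toLp (Ψ : C(X, ℂ) →⋆ₐ[ℂ] (H →L[ℂ] H)) (x : H) (f : C(X, ℂ)) :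
    ‖Ψ f x‖ = ‖ContinuousMap.toLp 2 (vecMeasure Ψ x) ℂ f‖ := by
  have h : ‖ContinuousMap.toLp 2 (vecMeasure Ψ x) ℂ f‖ ^ 2 = ‖Ψ f x‖ ^ 2 := by
    rw [norm_map_sq, ← RCLike.ofReal_inj (K := ℂ)]
    rw [RCLike.ofReal_pow, ← inner_self_eq_norm_sq_to_K (𝕜 := ℂ), L2.inner_def,
      ← integral_ofReal]
    refine integral_congr_ae ?_
    filter_upwards [ContinuousMap.coeFn_toLp (p := 2) (𝕜 := ℂ) (vecMeasure Ψ x) f] with y hy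
    rw [hy, inner_self_eq_norm_sq_to_K]
    simp
  exact ((pow_left_inj₀ (norm_nonneg _) (norm_nonneg _) two_ne_zero).mp h).symm

end BorelExtension

/-! ### The Borel functional calculus -/

section Calculus

variable {α : Type*} [MeasurableSpace α] {H : Type*} [NormedAddCommGroup H] [NormedSpace ℂ H]

/-- A bounded Borel functional calculus: a bounded homomorphism from the algebra of bounded
measurable functions to the bounded operators which respects bounded pointwise convergence. The
values of `F` at other functions play no role. -/
structure IsBorelCalculus (F : (α → ℂ) → H →L[ℂ] H) : Prop where
  add : ∀ φ ψ, IsBddMeas φ → IsBddMeas ψ → F (φ + ψ) = F φ + F ψ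
  smul : ∀ (z : ℂ) φ, IsBddMeas φ → F (z • φ) = z • F φ
  mul : ∀ φ ψ, IsBddMeas φ → IsBddMeas ψ → F (φ * ψ) = F φ ∘L F ψ
  one : F 1 = ContinuousLinearMap.id ℂ H
  bound : ∃ C : ℝ, 0 < C ∧ ∀ (φ : α → ℂ) (c : ℝ), Measurable φ → 0 ≤ c → (∀ x, ‖φ x‖ ≤ c) →
    ‖F φ‖ ≤ C * c
  tendsto : ∀ (φ : ℕ → α → ℂ) (ψ : α → ℂ) (c : ℝ), (∀ n, Measurable (φ n)) → Measurable ψ →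
    (∀ n x, ‖φ n x‖ ≤ c) → (∀ x, Tendsto (fun n => φ n x) atTop (𝓝 (ψ x))) →
    ∀ f : H, Tendsto (fun n => F (φ n) f) atTop (𝓝 (F ψ f))

end Calculus

section BorelExtension

variable {X : Type*} [TopologicalSpace X] [CompactSpace X] [T2Space X] [MeasurableSpace X]
  [BorelSpace X]
  {H : Type*} [NormedAddCommGroup H] [InnerProductSpace ℂ H] [CompleteSpace H]

/-- The map `f ↦ f x` for a representation of the continuous functions. -/
def evalMap (Ψ : C(X, ℂ) →⋆ₐ[ℂ] (H →L[ℂ] H)) (x : H) : C(X, ℂ) →ₗ[ℂ] H where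
  toFun f := Ψ f x
  map_add' := by simp
  map_smul' := by simp

/-- The vector `φ x`, for `φ` in `L²` of the spectral measure of `x`, by continuous extension of
the isometry `f ↦ f x` defined on continuous functions. -/
def vecExt (Ψ : C(X, ℂ) →⋆ₐ[ℂ] (H →L[ℂ] H)) (x : H) : Lp ℂ 2 (vecMeasure Ψ x) →L[ℂ] H :=
  LinearMap.extendOfNorm (evalMap Ψ x)
    (ContinuousMap.toLp 2 (vecMeasure Ψ x) ℂ : C(X, ℂ) →L[ℂ] Lp ℂ 2 (vecMeasure Ψ x)).toLinearMap

theorem vecExt_toLp (Ψ : C(X, ℂ) →⋆ₐ[ℂ] (H →L[ℂ] H)) (x : H) (f : C(X, ℂ)) :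
    vecExt Ψ x (ContinuousMap.toLp 2 (vecMeasure Ψ x) ℂ f) = Ψ f x :=
  LinearMap.extendOfNorm_eq (f := evalMap Ψ x)
    (e := (ContinuousMap.toLp 2 (vecMeasure Ψ x) ℂ :
      C(X, ℂ) →L[ℂ] Lp ℂ 2 (vecMeasure Ψ x)).toLinearMap)
    (ContinuousMap.toLp_denseRange ℂ (vecMeasure Ψ x) ℂ (p := 2) (by norm_num))
    ⟨1, fun f => by rw [one_mul]; exact (norm_map_eq_norm_toLp Ψ x f).le⟩ f

theorem norm_vecExt_le (Ψ : C(X, ℂ) →⋆ₐ[ℂ] (H →L[ℂ] H)) (x : H) (g : Lp ℂ 2 (vecMeasure Ψ x)) :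
    ‖vecExt Ψ x g‖ ≤ ‖g‖ := by
  have := LinearMap.norm_extendOfNorm_apply_le
    (f := evalMap Ψ x)
    (e := (ContinuousMap.toLp 2 (vecMeasure Ψ x) ℂ :
      C(X, ℂ) →L[ℂ] Lp ℂ 2 (vecMeasure Ψ x)).toLinearMap)
    (ContinuousMap.toLp_denseRange ℂ (vecMeasure Ψ x) ℂ (p := 2) (by norm_num)) 1
    (fun f => by rw [one_mul]; exact (norm_map_eq_norm_toLp Ψ x f).le) g
  rwa [one_mul] at this

/-- The value `φ x` of the Borel functional calculus at a vector `x`. -/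
def borelVec (Ψ : C(X, ℂ) →⋆ₐ[ℂ] (H →L[ℂ] H)) {φ : X → ℂ} (hφ : IsBddMeas φ) (x : H) : H :=
  vecExt Ψ x (hφ.memLp (vecMeasure Ψ x)).toLp

theorem norm_borelVec_sub_le (Ψ : C(X, ℂ) →⋆ₐ[ℂ] (H →L[ℂ] H)) {φ ψ : X → ℂ}
    (hφ : IsBddMeas φ) (hψ : IsBddMeas ψ) (x : H) :
    ‖borelVec Ψ hφ x - borelVec Ψ hψ x‖ ≤ (eLpNorm (φ - ψ) 2 (vecMeasure Ψ x)).toReal := by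
  rw [borelVec, borelVec, ← map_sub, ← MemLp.toLp_sub]
  exact (norm_vecExt_le Ψ x _).trans (Lp.norm_toLp _ _).le

theorem borelVec_continuousMap (Ψ : C(X, ℂ) →⋆ₐ[ℂ] (H →L[ℂ] H)) (f : C(X, ℂ)) (x : H) :
    borelVec Ψ (isBddMeas_continuousMap f) x = Ψ f x := by
  rw [← vecExt_toLp, borelVec]
  congr 1

theorem tendsto_borelVec (Ψ : C(X, ℂ) →⋆ₐ[ℂ] (H →L[ℂ] H)) {φ : ℕ → X → ℂ} {ψ : X → ℂ}
    (hφ : ∀ n, IsBddMeas (φ n)) (hψ : IsBddMeas ψ) {x : H}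
    (h : Tendsto (fun n => eLpNorm (φ n - ψ) 2 (vecMeasure Ψ x)) atTop (𝓝 0)) :
    Tendsto (fun n => borelVec Ψ (hφ n) x) atTop (𝓝 (borelVec Ψ hψ x)) := by
  rw [tendsto_iff_norm_sub_tendsto_zero]
  refine squeeze_zero (fun _ => norm_nonneg _) (fun n => norm_borelVec_sub_le Ψ (hφ n) hψ x) ?_
  simpa [Function.comp_def] using (ENNReal.tendsto_toReal ENNReal.zero_ne_top).comp h

/-- A bounded Borel function is approximated by one sequence of continuous functions in `L²` of
the spectral measures of finitely many vectors at once. This is what makes the calculus linear and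
multiplicative. -/
theorem exists_continuousMap_tendsto (Ψ : C(X, ℂ) →⋆ₐ[ℂ] (H →L[ℂ] H)) {ι : Type*} [Fintype ι]
    (v : ι → H) {φ : X → ℂ} (hφ : IsBddMeas φ) : ∃ f : ℕ → C(X, ℂ), ∀ i,
      Tendsto (fun n => eLpNorm (⇑(f n) - φ) 2 (vecMeasure Ψ (v i))) atTop (𝓝 0) := by
  let μ : Measure X := ∑ i, vecMeasure Ψ (v i)
  have hreg : μ.Regular := by
    classical
    refine Finset.sum_induction (fun i => vecMeasure Ψ (v i)) (fun ν => ν.Regular)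
      (fun a b ha hb => ?_) inferInstance (fun i _ => inferInstance)
    infer_instance
  have hle : ∀ i, vecMeasure Ψ (v i) ≤ μ := fun i =>
    Finset.single_le_sum (f := fun i => vecMeasure Ψ (v i)) (fun _ _ => Measure.zero_le _)
      (Finset.mem_univ i)
  have h : ∀ n : ℕ, ∃ f : C(X, ℂ), eLpNorm (⇑f - φ) 2 μ ≤ ((n : ENNReal) + 1)⁻¹ := by
    intro n
    obtain ⟨g, hg, -⟩ := (hφ.memLp μ).exists_boundedContinuous_eLpNorm_sub_le (by norm_num)
      (ε := ((n : ENNReal) + 1)⁻¹) (by simp)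
    refine ⟨g.toContinuousMap, ?_⟩
    rw [eLpNorm_sub_comm]
    exact hg
  choose f hf using h
  refine ⟨f, fun i => ?_⟩
  refine tendsto_of_tendsto_of_tendsto_of_le_of_le tendsto_const_nhds ?_ (fun _ => zero_le)
    (fun n => (eLpNorm_mono_measure _ (hle i)).trans (hf n))
  have := ENNReal.tendsto_inv_nat_nhds_zero.comp (tendsto_add_atTop_nat 1)
  simpa [Function.comp_def] using this

theorem exists_continuousMap_tendsto_borelVec (Ψ : C(X, ℂ) →⋆ₐ[ℂ] (H →L[ℂ] H)) {ι : Type*}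
    [Fintype ι] (v : ι → H) {φ : X → ℂ} (hφ : IsBddMeas φ) : ∃ f : ℕ → C(X, ℂ), ∀ i,
      Tendsto (fun n => eLpNorm (⇑(f n) - φ) 2 (vecMeasure Ψ (v i))) atTop (𝓝 0) ∧
      Tendsto (fun n => Ψ (f n) (v i)) atTop (𝓝 (borelVec Ψ hφ (v i))) := by
  obtain ⟨f, hf⟩ := exists_continuousMap_tendsto Ψ v hφ
  refine ⟨f, fun i => ⟨hf i, ?_⟩⟩
  simpa only [borelVec_continuousMap] using
    tendsto_borelVec Ψ (fun n => isBddMeas_continuousMap (f n)) hφ (hf i)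

theorem measureReal_univ_vecMeasure (Ψ : C(X, ℂ) →⋆ₐ[ℂ] (H →L[ℂ] H)) (x : H) :
    (vecMeasure Ψ x).real Set.univ = ‖x‖ ^ 2 := by
  have h := norm_map_sq Ψ x 1
  simpa using h.symm

theorem norm_borelVec_le (Ψ : C(X, ℂ) →⋆ₐ[ℂ] (H →L[ℂ] H)) {φ : X → ℂ} (hφ : IsBddMeas φ)
    {c : ℝ} (hc : 0 ≤ c) (h : ∀ y, ‖φ y‖ ≤ c) (x : H) : ‖borelVec Ψ hφ x‖ ≤ c * ‖x‖ := by
  refine (norm_vecExt_le Ψ x _).trans ((Lp.norm_toLp _ _).le.trans ?_)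
  have h1 := eLpNorm_le_of_ae_bound (p := 2) (μ := vecMeasure Ψ x) (Eventually.of_forall h)
  have h2 : (vecMeasure Ψ x) Set.univ = ENNReal.ofReal (‖x‖ ^ 2) := by
    rw [← measureReal_univ_vecMeasure Ψ x, ofReal_measureReal]
  have h3 : (vecMeasure Ψ x) Set.univ ^ (2 : ENNReal).toReal⁻¹ = ENNReal.ofReal ‖x‖ := by
    rw [h2, ENNReal.ofReal_rpow_of_nonneg (by positivity) (by norm_num)]
    congr 1
    rw [ENNReal.toReal_ofNat, ← one_div, ← Real.sqrt_eq_rpow, Real.sqrt_sq (norm_nonneg x)]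
  rw [h3, ← ENNReal.ofReal_mul (norm_nonneg x)] at h1
  rw [mul_comm]
  exact ENNReal.toReal_le_of_le_ofReal (by positivity) h1

theorem borelVec_add (Ψ : C(X, ℂ) →⋆ₐ[ℂ] (H →L[ℂ] H)) {φ : X → ℂ} (hφ : IsBddMeas φ) (x y : H) :
    borelVec Ψ hφ (x + y) = borelVec Ψ hφ x + borelVec Ψ hφ y := by
  obtain ⟨f, hf⟩ := exists_continuousMap_tendsto_borelVec Ψ ![x, y, x + y] hφ
  have h1 := ((hf 0).2.add (hf 1).2)
  have h2 := (hf 2).2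
  simp only [Matrix.cons_val] at h1 h2
  exact tendsto_nhds_unique (by simpa using h2) h1

theorem borelVec_smul (Ψ : C(X, ℂ) →⋆ₐ[ℂ] (H →L[ℂ] H)) {φ : X → ℂ} (hφ : IsBddMeas φ) (z : ℂ)
    (x : H) : borelVec Ψ hφ (z • x) = z • borelVec Ψ hφ x := by
  obtain ⟨f, hf⟩ := exists_continuousMap_tendsto_borelVec Ψ ![x, z • x] hφ
  have h1 := ((hf 0).2.const_smul z)
  have h2 := (hf 1).2
  simp only [Matrix.cons_val] at h1 h2
  exact tendsto_nhds_unique (by simpa using h2) h1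

open Classical in
/-- The extension of a representation of the continuous functions on a compact space to the bounded
Borel functions (with value `0` at all other functions). -/
def borelExt (Ψ : C(X, ℂ) →⋆ₐ[ℂ] (H →L[ℂ] H)) (φ : X → ℂ) : H →L[ℂ] H :=
  if hφ : IsBddMeas φ then
    LinearMap.mkContinuousOfExistsBound
      { toFun := borelVec Ψ hφ, map_add' := borelVec_add Ψ hφ, map_smul' := borelVec_smul Ψ hφ }
      (by
        obtain ⟨c, hc⟩ := hφ.2
        refine ⟨|c|, fun x => ?_⟩
        exact norm_borelVec_le Ψ hφ (abs_nonneg c) (fun y => (hc y).trans (le_abs_self c)) x)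
  else 0

theorem borelExt_apply (Ψ : C(X, ℂ) →⋆ₐ[ℂ] (H →L[ℂ] H)) {φ : X → ℂ} (hφ : IsBddMeas φ) (x : H) :
    borelExt Ψ φ x = borelVec Ψ hφ x := by
  rw [borelExt, dif_pos hφ]
  rfl

theorem borelExt_continuousMap (Ψ : C(X, ℂ) →⋆ₐ[ℂ] (H →L[ℂ] H)) (f : C(X, ℂ)) :
    borelExt Ψ f = Ψ f := by
  ext x
  rw [borelExt_apply Ψ (isBddMeas_continuousMap f), borelVec_continuousMap]

theorem borelExt_add (Ψ : C(X, ℂ) →⋆ₐ[ℂ] (H →L[ℂ] H)) {φ ψ : X → ℂ} (hφ : IsBddMeas φ)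
    (hψ : IsBddMeas ψ) : borelExt Ψ (φ + ψ) = borelExt Ψ φ + borelExt Ψ ψ := by
  ext x
  rw [add_apply, borelExt_apply Ψ hφ, borelExt_apply Ψ hψ, borelExt_apply Ψ (hφ.add hψ),
    borelVec, borelVec, borelVec, ← map_add]
  rfl

theorem borelExt_smul (Ψ : C(X, ℂ) →⋆ₐ[ℂ] (H →L[ℂ] H)) {φ : X → ℂ} (z : ℂ) (hφ : IsBddMeas φ) :
    borelExt Ψ (z • φ) = z • borelExt Ψ φ := by
  ext x
  rw [smul_apply, borelExt_apply Ψ hφ, borelExt_apply Ψ (hφ.smul z), borelVec, borelVec,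
    ← map_smul]
  rfl

theorem borelExt_continuousMap_mul (Ψ : C(X, ℂ) →⋆ₐ[ℂ] (H →L[ℂ] H)) (f : C(X, ℂ)) {ψ : X → ℂ}
    (hψ : IsBddMeas ψ) : borelExt Ψ (f * ψ) = Ψ f ∘L borelExt Ψ ψ := by
  ext x
  obtain ⟨g, hg⟩ := exists_continuousMap_tendsto_borelVec Ψ (fun _ : Unit => x) hψ
  have hf := isBddMeas_continuousMap f
  rw [ContinuousLinearMap.comp_apply, borelExt_apply Ψ hψ, borelExt_apply Ψ (hf.mul hψ)]
  have h1 := ((Ψ f).continuous.tendsto _).comp (hg ()).2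
  have h2 : Tendsto (fun n => borelVec Ψ (isBddMeas_continuousMap (f * g n)) x) atTop
      (𝓝 (borelVec Ψ (hf.mul hψ) x)) := by
    refine tendsto_borelVec Ψ _ _ ?_
    have h3 : Tendsto (fun n => ENNReal.ofReal ‖f‖ * eLpNorm (⇑(g n) - ψ) 2 (vecMeasure Ψ x)) atTop
        (𝓝 0) := by
      simpa using ENNReal.Tendsto.const_mul (hg ()).1 (Or.inr (ENNReal.ofReal_ne_top (r := ‖f‖)))
    refine tendsto_of_tendsto_of_tendsto_of_le_of_le tendsto_const_nhds h3 (fun _ => zero_le)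
      (fun n => ?_)
    refine eLpNorm_le_mul_eLpNorm_of_ae_le_mul (Eventually.of_forall fun y => ?_) 2
    have : (⇑(f * g n) - ⇑f * ψ) y = f y * (⇑(g n) - ψ) y := by simp [mul_sub]
    rw [this, norm_mul]
    exact mul_le_mul_of_nonneg_right (f.norm_coe_le_norm y) (norm_nonneg _)
  refine tendsto_nhds_unique h2 ?_
  refine h1.congr fun n => ?_
  rw [borelVec_continuousMap, map_mul]
  rfl

theorem borelExt_mul (Ψ : C(X, ℂ) →⋆ₐ[ℂ] (H →L[ℂ] H)) {φ ψ : X → ℂ} (hφ : IsBddMeas φ)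
    (hψ : IsBddMeas ψ) : borelExt Ψ (φ * ψ) = borelExt Ψ φ ∘L borelExt Ψ ψ := by
  ext x
  obtain ⟨c, hc⟩ := hψ.2
  obtain ⟨f, hf⟩ := exists_continuousMap_tendsto_borelVec Ψ ![x, borelExt Ψ ψ x] hφ
  have h0 := hf 0
  have h1 := (hf 1).2
  simp only [Matrix.cons_val] at h0 h1
  rw [ContinuousLinearMap.comp_apply, borelExt_apply Ψ hφ, borelExt_apply Ψ (hφ.mul hψ)]
  refine tendsto_nhds_unique ?_ h1
  have h2 : Tendsto (fun n => borelVec Ψ ((isBddMeas_continuousMap (f n)).mul hψ) x) atTop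
      (𝓝 (borelVec Ψ (hφ.mul hψ) x)) := by
    refine tendsto_borelVec Ψ _ _ ?_
    have h3 : Tendsto (fun n => ENNReal.ofReal c * eLpNorm (⇑(f n) - φ) 2 (vecMeasure Ψ x)) atTop
        (𝓝 0) := by
      simpa using ENNReal.Tendsto.const_mul h0.1 (Or.inr (ENNReal.ofReal_ne_top (r := c)))
    refine tendsto_of_tendsto_of_tendsto_of_le_of_le tendsto_const_nhds h3 (fun _ => zero_le)
      (fun n => ?_)
    refine eLpNorm_le_mul_eLpNorm_of_ae_le_mul (Eventually.of_forall fun y => ?_) 2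
    have : (⇑(f n) * ψ - φ * ψ) y = ψ y * (⇑(f n) - φ) y := by
      simp only [Pi.sub_apply, Pi.mul_apply]; ring
    rw [this, norm_mul]
    exact mul_le_mul_of_nonneg_right (hc y) (norm_nonneg _)
  refine h2.congr fun n => ?_
  rw [← borelExt_apply, borelExt_continuousMap_mul Ψ _ hψ, ContinuousLinearMap.comp_apply]

theorem adjoint_borelExt (Ψ : C(X, ℂ) →⋆ₐ[ℂ] (H →L[ℂ] H)) {φ : X → ℂ} (hφ : IsBddMeas φ) :
    ContinuousLinearMap.adjoint (borelExt Ψ φ) = borelExt Ψ (star φ) := by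
  symm
  rw [ContinuousLinearMap.eq_adjoint_iff]
  intro x y
  obtain ⟨f, hf⟩ := exists_continuousMap_tendsto_borelVec Ψ ![x, y] hφ
  have h0 := (hf 0).1
  have h1 := (hf 1).2
  simp only [Matrix.cons_val] at h0 h1
  have h2 : Tendsto (fun n => borelVec Ψ (isBddMeas_continuousMap (star (f n))) x) atTop
      (𝓝 (borelVec Ψ hφ.star x)) := by
    refine tendsto_borelVec Ψ _ _ (h0.congr fun n => ?_)
    refine eLpNorm_congr_norm_ae (Eventually.of_forall fun z => ?_)
    simp only [Pi.sub_apply, ContinuousMap.star_apply, Pi.star_apply, ← star_sub, norm_star]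
  rw [borelExt_apply Ψ hφ.star, borelExt_apply Ψ hφ]
  refine tendsto_nhds_unique (h2.inner tendsto_const_nhds) ?_
  refine (tendsto_const_nhds.inner h1).congr fun n => ?_
  rw [borelVec_continuousMap, map_star, ContinuousLinearMap.star_eq_adjoint,
    ContinuousLinearMap.adjoint_inner_left]

theorem isBorelCalculus_borelExt (Ψ : C(X, ℂ) →⋆ₐ[ℂ] (H →L[ℂ] H)) :
    IsBorelCalculus (borelExt Ψ) where
  add φ ψ hφ hψ := borelExt_add Ψ hφ hψ
  smul z φ hφ := borelExt_smul Ψ z hφ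
  mul φ ψ hφ hψ := borelExt_mul Ψ hφ hψ
  one := by
    have := borelExt_continuousMap Ψ 1
    rw [map_one] at this
    exact this
  bound := by
    refine ⟨1, one_pos, fun φ c hφ hc h => ?_⟩
    rw [one_mul]
    refine ContinuousLinearMap.opNorm_le_bound _ hc fun x => ?_
    rw [borelExt_apply Ψ ⟨hφ, c, h⟩]
    exact norm_borelVec_le Ψ _ hc h x
  tendsto φ ψ c hφ hψ hc hlim f := by
    have hψc : IsBddMeas ψ :=
      ⟨hψ, c, fun x => le_of_tendsto (hlim x).norm (Eventually.of_forall fun n => hc n x)⟩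
    have h1 := tendsto_borelVec Ψ (fun n => ⟨hφ n, c, hc n⟩) hψc (x := f)
      (tendsto_eLpNorm_two_of_dominated hφ hψ hc hlim)
    rw [borelExt_apply Ψ hψc]
    exact h1.congr fun n => (borelExt_apply Ψ ⟨hφ n, c, hc n⟩ f).symm

end BorelExtension

/-! ### The spectral measure of a Borel functional calculus -/

section SpectralMeasure

variable {α : Type*} [MeasurableSpace α] {H : Type*} [NormedAddCommGroup H] [NormedSpace ℂ H]
  {F : (α → ℂ) → H →L[ℂ] H}

/-- The set function of a functional calculus: the values at the indicator functions. -/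
def calcMeasure (F : (α → ℂ) → H →L[ℂ] H) (b : Set α) : H →L[ℂ] H := F (b.indicator 1)

namespace IsBorelCalculus

theorem neg (hF : IsBorelCalculus F) {φ : α → ℂ} (hφ : IsBddMeas φ) : F (-φ) = -F φ := by
  simpa using hF.smul (-1) φ hφ

theorem sub (hF : IsBorelCalculus F) {φ ψ : α → ℂ} (hφ : IsBddMeas φ) (hψ : IsBddMeas ψ) :
    F (φ - ψ) = F φ - F ψ := by
  rw [sub_eq_add_neg, hF.add _ _ hφ hψ.neg, hF.neg hψ, sub_eq_add_neg]

theorem zero (hF : IsBorelCalculus F) : F 0 = 0 := by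
  simpa using hF.smul 0 1 isBddMeas_one

theorem sum (hF : IsBorelCalculus F) {ι : Type*} (s : Finset ι) (φ : ι → α → ℂ)
    (hφ : ∀ i, IsBddMeas (φ i)) :
    IsBddMeas (∑ i ∈ s, φ i) ∧ F (∑ i ∈ s, φ i) = ∑ i ∈ s, F (φ i) := by
  classical
  induction s using Finset.induction_on with
  | empty => exact ⟨isBddMeas_const (0 : ℂ), by simpa using hF.zero⟩
  | insert i s hi ih =>
    rw [Finset.sum_insert hi, Finset.sum_insert hi, ← ih.2]
    exact ⟨(hφ i).add ih.1, hF.add _ _ (hφ i) ih.1⟩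

theorem isSpectralMeasure (hF : IsBorelCalculus F) : IsSpectralMeasure (calcMeasure F) where
  bounded := by
    obtain ⟨C, -, hC⟩ := hF.bound
    refine ⟨C * 1, fun b hb => hC _ 1 (measurable_one.indicator hb) zero_le_one fun x => ?_⟩
    by_cases hx : x ∈ b <;> simp [hx]
  empty := by rw [calcMeasure, Set.indicator_empty]; exact hF.zero
  univ := by rw [calcMeasure, Set.indicator_univ, hF.one]
  inter b d hb hd := by
    rw [calcMeasure, Set.inter_indicator_one,
      hF.mul _ _ (isBddMeas_indicator_one hb) (isBddMeas_indicator_one hd)]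
    rfl
  union b d hb hd := by
    have hb' := isBddMeas_indicator_one hb
    have hd' := isBddMeas_indicator_one hd
    have h : (b ∪ d).indicator (1 : α → ℂ) =
        b.indicator 1 + d.indicator 1 - b.indicator 1 * d.indicator 1 := by
      ext x
      by_cases hx : x ∈ b <;> by_cases hy : x ∈ d <;> simp [hx, hy]
    rw [calcMeasure, h, hF.sub (hb'.add hd') (hb'.mul hd'), hF.add _ _ hb' hd',
      hF.mul _ _ hb' hd']
    rfl
  iUnion b hb hdis f := by
    have hsum : ∀ s : Finset ℕ, ∑ i ∈ s, calcMeasure F (b i) f =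
        F ((⋃ i ∈ s, b i).indicator 1) f := by
      intro s
      have h1 : (⋃ i ∈ s, b i).indicator (1 : α → ℂ) = ∑ i ∈ s, (b i).indicator 1 := by
        ext x
        rw [Finset.indicator_biUnion_apply s b (fun i _ j _ hij => hdis hij), Finset.sum_apply]
      rw [h1, (hF.sum s _ fun i => isBddMeas_indicator_one (hb i)).2]
      simp [calcMeasure]
    -- the filter of finite subsets of `ℕ` is countably generated, so sequences are enough
    refine tendsto_iff_seq_tendsto.mpr fun s hs => ?_
    have h2 : ((fun s => ∑ i ∈ s, calcMeasure F (b i) f) ∘ s) =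
        fun n => F ((⋃ i ∈ s n, b i).indicator 1) f := by
      ext n; exact hsum (s n)
    simp only [SummationFilter.unconditional_filter] at hs ⊢
    rw [h2]
    refine hF.tendsto _ _ 1 (fun n => measurable_one.indicator ?_)
      (measurable_one.indicator (MeasurableSet.iUnion hb)) (fun n x => ?_) (fun x => ?_) f
    · exact Finset.measurableSet_biUnion _ fun i _ => hb i
    · by_cases hx : x ∈ ⋃ i ∈ s n, b i <;> simp only [hx, Set.indicator_of_mem,
        Set.indicator_of_notMem, not_false_eq_true] <;> simp
    · by_cases hx : x ∈ ⋃ i, b i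
      · obtain ⟨i, hi⟩ := Set.mem_iUnion.mp hx
        refine tendsto_const_nhds.congr' ?_
        filter_upwards [hs.eventually (eventually_ge_atTop {i})] with n hn
        have : x ∈ ⋃ i ∈ s n, b i := Set.mem_iUnion₂.mpr ⟨i, by simpa using hn, hi⟩
        rw [Set.indicator_of_mem this, Set.indicator_of_mem hx]
      · refine tendsto_const_nhds.congr fun n => ?_
        have : x ∉ ⋃ i ∈ s n, b i := fun h => by
          obtain ⟨i, -, hi⟩ := Set.mem_iUnion₂.mp h
          exact hx (Set.mem_iUnion.mpr ⟨i, hi⟩)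
        rw [Set.indicator_of_notMem this, Set.indicator_of_notMem hx]

theorem simpleIntegral_eq (hF : IsBorelCalculus F) {b : Set α} (hb : MeasurableSet b)
    (s : SimpleFunc α ℂ) : simpleIntegral (calcMeasure F) b s = F (b.indicator s) := by
  have h1 : b.indicator s = ∑ c ∈ s.range, c • (s ⁻¹' {c} ∩ b).indicator (1 : α → ℂ) := by
    ext x
    rw [Finset.sum_apply, Finset.sum_eq_single (s x)]
    · by_cases hx : x ∈ b <;> simp [hx]
    · intro c _ hc
      simp [Set.indicator_of_notMem, hc.symm]
    · intro h
      exact absurd (s.mem_range_self x) h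
  have h2 : ∀ c, IsBddMeas ((s ⁻¹' {c} ∩ b).indicator (1 : α → ℂ)) := fun c =>
    isBddMeas_indicator_one ((s.measurableSet_preimage {c}).inter hb)
  rw [h1, (hF.sum s.range _ fun c => (h2 c).smul c).2]
  exact Finset.sum_congr rfl fun c _ => (hF.smul c _ (h2 c)).symm

end IsBorelCalculus

/-- A measurable function that is bounded on `b` is a uniform limit of simple functions on `b`:
round the real and imaginary parts down to multiples of `1 / (n + 1)`. -/
theorem exists_simpleFunc_tendstoUniformlyOn {φ : α → ℂ} (hφ : Measurable φ) {b : Set α}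
    (hb : MeasurableSet b) {c : ℝ} (hc : ∀ x ∈ b, ‖φ x‖ ≤ c) :
    ∃ s : ℕ → SimpleFunc α ℂ, TendstoUniformlyOn (fun n => ⇑(s n)) φ atTop b := by
  classical
  let r : ℕ → ℤ × ℤ → ℂ := fun n p =>
    ((p.1 / (n + 1) : ℝ) : ℂ) + ((p.2 / (n + 1) : ℝ) : ℂ) * Complex.I
  let p : ℕ → α → ℤ × ℤ := fun n x => (⌊(n + 1) * (φ x).re⌋, ⌊(n + 1) * (φ x).im⌋)
  have hp : ∀ n, Measurable (p n) := fun n =>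
    ((Complex.measurable_re.comp hφ).const_mul _).floor.prodMk
      ((Complex.measurable_im.comp hφ).const_mul _).floor
  have hfin : ∀ n, (Set.range fun x => if x ∈ b then r n (p n x) else 0).Finite := by
    intro n
    let K : Set (ℤ × ℤ) :=
      Set.Icc ⌊(n + 1) * -c⌋ ⌊(n + 1) * c⌋ ×ˢ Set.Icc ⌊(n + 1) * -c⌋ ⌊(n + 1) * c⌋
    have hK : K.Finite := (Set.finite_Icc _ _).prod (Set.finite_Icc _ _)
    refine ((hK.image (r n)).insert 0).subset ?_
    rintro _ ⟨x, rfl⟩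
    by_cases hx : x ∈ b
    · right
      have hn : (0 : ℝ) ≤ n + 1 := by positivity
      have h1 := abs_le.mp ((Complex.abs_re_le_norm (φ x)).trans (hc x hx))
      have h2 := abs_le.mp ((Complex.abs_im_le_norm (φ x)).trans (hc x hx))
      simp only [hx, if_true]
      refine ⟨p n x, ⟨⟨?_, ?_⟩, ⟨?_, ?_⟩⟩, rfl⟩ <;> refine Int.floor_le_floor ?_ <;>
        refine mul_le_mul_of_nonneg_left ?_ hn
      exacts [h1.1, h1.2, h2.1, h2.2]
    · simp [hx]
  have hmeas : ∀ n, Measurable fun x => if x ∈ b then r n (p n x) else 0 := fun n =>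
    Measurable.ite hb ((measurable_of_countable (r n)).comp (hp n)) measurable_const
  refine ⟨fun n => ⟨_, fun z => hmeas n (measurableSet_singleton z), hfin n⟩, ?_⟩
  rw [Metric.tendstoUniformlyOn_iff]
  intro ε hε
  have hlim : Tendsto (fun n : ℕ => 2 * (1 / ((n : ℝ) + 1))) atTop (𝓝 0) := by
    simpa using (tendsto_one_div_add_atTop_nhds_zero_nat (𝕜 := ℝ)).const_mul 2
  filter_upwards [hlim.eventually_lt_const hε] with n hn x hx
  refine lt_of_le_of_lt ?_ hn
  have hn0 : (0 : ℝ) < n + 1 := by positivity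
  have key : ∀ t : ℝ, |t - ⌊(n + 1) * t⌋ / (n + 1)| ≤ 1 / (n + 1) := by
    intro t
    have h1 := Int.floor_le ((n + 1) * t)
    have h2 := Int.lt_floor_add_one ((n + 1) * t)
    rw [abs_le]
    constructor
    · rw [le_sub_iff_add_le, ← le_sub_iff_add_le', div_le_iff₀ hn0, sub_mul, neg_mul,
        div_mul_cancel₀ _ hn0.ne']
      linarith
    · rw [sub_le_iff_le_add, ← add_div, le_div_iff₀ hn0]
      linarith
  rw [dist_eq_norm]
  change ‖φ x - (if x ∈ b then r n (p n x) else 0)‖ ≤ _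
  simp only [hx, if_true]
  refine (Complex.norm_le_abs_re_add_abs_im _).trans ?_
  have h1 : (φ x - r n (p n x)).re = (φ x).re - ⌊(n + 1) * (φ x).re⌋ / (n + 1) := by
    simp [r, p, -Complex.ofReal_div]
  have h2 : (φ x - r n (p n x)).im = (φ x).im - ⌊(n + 1) * (φ x).im⌋ / (n + 1) := by
    simp [r, p, -Complex.ofReal_div]
  rw [h1, h2, two_mul]
  exact add_le_add (key _) (key _)

theorem IsBorelCalculus.hasSpectralIntegral (hF : IsBorelCalculus F) {φ : α → ℂ}
    (hφ : Measurable φ) {b : Set α} (hb : MeasurableSet b) {c : ℝ} (hc : ∀ x ∈ b, ‖φ x‖ ≤ c) :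
    HasSpectralIntegral (calcMeasure F) φ b (F (b.indicator φ)) := by
  obtain ⟨s, hs⟩ := exists_simpleFunc_tendstoUniformlyOn hφ hb hc
  refine ⟨s, hs, ?_⟩
  obtain ⟨C, hC0, hC⟩ := hF.bound
  have hbφ : IsBddMeas (b.indicator φ) := by
    refine ⟨hφ.indicator hb, max c 0, fun x => ?_⟩
    by_cases hx : x ∈ b
    · simpa [hx] using Or.inl (hc x hx)
    · simp [hx]
  have hbs : ∀ n, IsBddMeas (b.indicator (s n)) := by
    intro n
    obtain ⟨d, hd⟩ := (s n).finite_range.isBounded.exists_norm_le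
    refine ⟨(s n).measurable.indicator hb, max d 0, fun x => ?_⟩
    by_cases hx : x ∈ b
    · simpa [hx] using Or.inl (hd _ (Set.mem_range_self x))
    · simp [hx]
  rw [Metric.tendsto_atTop]
  intro ε hε
  rw [Metric.tendstoUniformlyOn_iff] at hs
  obtain ⟨N, hN⟩ := eventually_atTop.mp (hs (ε / (2 * C)) (by positivity))
  refine ⟨N, fun n hn => ?_⟩
  rw [hF.simpleIntegral_eq hb, dist_eq_norm, ← hF.sub (hbs n) hbφ]
  have h1 : ‖F (b.indicator (s n) - b.indicator φ)‖ ≤ C * (ε / (2 * C)) := by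
    refine hC _ _ ((hbs n).sub hbφ).1 (by positivity) fun x => ?_
    by_cases hx : x ∈ b
    · have := hN n hn x hx
      rw [dist_comm, dist_eq_norm] at this
      simpa [hx] using this.le
    · simp only [Pi.sub_apply, hx, not_false_eq_true, Set.indicator_of_notMem, sub_self, norm_zero]
      positivity
  have h2 : C * (ε / (2 * C)) = ε / 2 := by field_simp
  linarith

/-- Push-forward of a Borel calculus under a measurable map. -/
theorem IsBorelCalculus.comp {β : Type*} [MeasurableSpace β] (hF : IsBorelCalculus F) {g : α → β}
    (hg : Measurable g) : IsBorelCalculus (fun φ : β → ℂ => F (φ ∘ g)) where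
  add φ ψ hφ hψ := hF.add _ _ (hφ.comp hg) (hψ.comp hg)
  smul z φ hφ := hF.smul z _ (hφ.comp hg)
  mul φ ψ hφ hψ := hF.mul _ _ (hφ.comp hg) (hψ.comp hg)
  one := hF.one
  bound := by
    obtain ⟨C, hC0, hC⟩ := hF.bound
    exact ⟨C, hC0, fun φ c hφ hc h => hC _ c (hφ.comp hg) hc fun x => h _⟩
  tendsto φ ψ c hφ hψ hc h := hF.tendsto _ _ c (fun n => (hφ n).comp hg) (hψ.comp hg)
    (fun n x => hc n _) (fun x => h _)

/-- A Borel calculus transported by a similarity. -/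
theorem IsBorelCalculus.conj (hF : IsBorelCalculus F) (V : H ≃L[ℂ] H) :
    IsBorelCalculus (fun φ => (V : H →L[ℂ] H) ∘L F φ ∘L (V.symm : H →L[ℂ] H)) where
  add φ ψ hφ hψ := by
    ext x; simp [hF.add φ ψ hφ hψ]
  smul z φ hφ := by
    ext x; simp [hF.smul z φ hφ]
  mul φ ψ hφ hψ := by
    ext x; simp [hF.mul φ ψ hφ hψ]
  one := by
    ext x; simp [hF.one]
  bound := by
    obtain ⟨C, hC0, hC⟩ := hF.bound
    let v : ℝ := ‖(V : H →L[ℂ] H)‖ + 1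
    let w : ℝ := ‖(V.symm : H →L[ℂ] H)‖ + 1
    have hv : 0 < v := by positivity
    have hw : 0 < w := by positivity
    refine ⟨v * C * w, by positivity, fun φ c hφ hc h => ?_⟩
    calc _ ≤ ‖(V : H →L[ℂ] H)‖ * (‖F φ‖ * ‖(V.symm : H →L[ℂ] H)‖) :=
          (ContinuousLinearMap.opNorm_comp_le _ _).trans
            (mul_le_mul_of_nonneg_left (ContinuousLinearMap.opNorm_comp_le _ _) (norm_nonneg _))
      _ ≤ v * ((C * c) * w) := by
          have := hC φ c hφ hc h
          gcongr
          · simp [v]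
          · simp [w]
      _ = v * C * w * c := by ring
  tendsto φ ψ c hφ hψ hc h f :=
    (V.continuous.tendsto _).comp (hF.tendsto φ ψ c hφ hψ hc h (V.symm f))

end SpectralMeasure

/-! ### Operators with a real spectral calculus are scalar spectral operators -/

section ScalarSpectral

variable {H : Type*} [NormedAddCommGroup H] [NormedSpace ℂ H]

theorem mem_graph_iff_exists {T : H →ₗ.[ℂ] H} {f g : H} :
    (f, g) ∈ T.graph ↔ ∃ h : f ∈ T.domain, T ⟨f, h⟩ = g := by
  simp [LinearPMap.mem_graph_iff]

theorem mem_resolventSet_iff {T : H →ₗ.[ℂ] H} {z : ℂ} :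
    z ∈ resolventSet T ↔ ∃ R : H →L[ℂ] H, (∀ x, (R x, x + z • R x) ∈ T.graph) ∧
      ∀ f g, (f, g) ∈ T.graph → R (g - z • f) = f := by
  constructor
  · rintro ⟨R, h1, h2⟩
    refine ⟨R, fun x => ?_, fun f g hfg => ?_⟩
    · obtain ⟨h, hx⟩ := h1 x
      exact mem_graph_iff_exists.mpr ⟨h, by rw [← sub_eq_iff_eq_add, hx]⟩
    · obtain ⟨h, rfl⟩ := mem_graph_iff_exists.mp hfg
      exact h2 ⟨f, h⟩
  · rintro ⟨R, h1, h2⟩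
    refine ⟨R, fun x => ?_, fun u => h2 _ _ (T.mem_graph u)⟩
    obtain ⟨h, hx⟩ := mem_graph_iff_exists.mp (h1 x)
    exact ⟨h, by rw [hx, add_sub_cancel_right]⟩

/-- `B` is the inverse of `T + t`, expressed on the graph of `T`. -/
def IsResolventAt (T : H →ₗ.[ℂ] H) (t : ℝ) (B : H →L[ℂ] H) : Prop :=
  ∀ f g, (f, g) ∈ T.graph ↔ B (g + (t : ℂ) • f) = f

theorem IsResolventAt.isClosed {T : H →ₗ.[ℂ] H} {t : ℝ} {B : H →L[ℂ] H}
    (h : IsResolventAt T t B) : T.IsClosed := by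
  have : (T.graph : Set (H × H)) = {p | B (p.2 + (t : ℂ) • p.1) = p.1} := by
    ext ⟨f, g⟩
    exact h f g
  rw [LinearPMap.IsClosed, this]
  exact isClosed_eq (by fun_prop) continuous_fst

theorem IsResolventAt.mem_graph {T : H →ₗ.[ℂ] H} {t : ℝ} {B : H →L[ℂ] H}
    (h : IsResolventAt T t B) (x : H) : (B x, x - (t : ℂ) • B x) ∈ T.graph := by
  rw [h, sub_add_cancel]

theorem IsResolventAt.eq {T T' : H →ₗ.[ℂ] H} {t : ℝ} {B : H →L[ℂ] H}
    (h : IsResolventAt T t B) (h' : IsResolventAt T' t B) : T = T' := by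
  refine LinearPMap.eq_of_eq_graph ?_
  ext ⟨f, g⟩
  rw [h f g, h' f g]

/-- `F` is a Borel functional calculus for the operator `T` on the real line, where
`B = (T + t)⁻¹`: it commutes with `B`, and `B` acts as division by `s + t`. -/
structure IsOperatorCalculus (F : (ℝ → ℂ) → H →L[ℂ] H) (T : H →ₗ.[ℂ] H) (t : ℝ)
    (B : H →L[ℂ] H) : Prop where
  borel : IsBorelCalculus F
  resolvent : IsResolventAt T t B
  comm : ∀ φ, IsBddMeas φ → ∀ x, B (F φ x) = F φ (B x)
  div : ∀ φ : ℝ → ℂ, IsBddMeas φ → IsBddMeas (fun s : ℝ => ((s : ℂ) + t) * φ s) →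
    ∀ x, B (F (fun s : ℝ => ((s : ℂ) + t) * φ s) x) = F φ x

namespace IsOperatorCalculus

variable {F : (ℝ → ℂ) → H →L[ℂ] H} {T : H →ₗ.[ℂ] H} {t : ℝ} {B : H →L[ℂ] H}

theorem apply_add_mul (hF : IsOperatorCalculus F T t B) {φ : ℝ → ℂ} (hφ : IsBddMeas φ)
    (hφ' : IsBddMeas (fun s : ℝ => (s : ℂ) * φ s)) :
    IsBddMeas (fun s : ℝ => ((s : ℂ) + t) * φ s) ∧
    F (fun s : ℝ => ((s : ℂ) + t) * φ s) = F (fun s : ℝ => (s : ℂ) * φ s) + (t : ℂ) • F φ := by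
  have h : (fun s : ℝ => ((s : ℂ) + t) * φ s) = (fun s : ℝ => (s : ℂ) * φ s) + (t : ℂ) • φ := by
    ext s; simp [add_mul]
  rw [h, hF.borel.add _ _ hφ' (hφ.smul _), hF.borel.smul _ _ hφ]
  exact ⟨hφ'.add (hφ.smul _), rfl⟩

theorem mem_graph (hF : IsOperatorCalculus F T t B) {φ : ℝ → ℂ} (hφ : IsBddMeas φ)
    (hφ' : IsBddMeas (fun s : ℝ => (s : ℂ) * φ s)) (x : H) :
    (F φ x, F (fun s : ℝ => (s : ℂ) * φ s) x) ∈ T.graph := by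
  obtain ⟨h1, h2⟩ := hF.apply_add_mul hφ hφ'
  have h3 := hF.div φ hφ h1 x
  rw [h2] at h3
  exact (hF.resolvent _ _).mpr h3

theorem apply_mul (hF : IsOperatorCalculus F T t B) {φ : ℝ → ℂ} (hφ : IsBddMeas φ)
    (hφ' : IsBddMeas (fun s : ℝ => (s : ℂ) * φ s)) {f g : H} (hfg : (f, g) ∈ T.graph) :
    F (fun s : ℝ => (s : ℂ) * φ s) f = F φ g := by
  obtain ⟨h1, h2⟩ := hF.apply_add_mul hφ hφ'
  have h3 := hF.div φ hφ h1 (g + (t : ℂ) • f)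
  rw [hF.comm _ h1, (hF.resolvent f g).mp hfg, h2] at h3
  simpa using h3

theorem map_graph (hF : IsOperatorCalculus F T t B) {φ : ℝ → ℂ} (hφ : IsBddMeas φ) {f g : H}
    (hfg : (f, g) ∈ T.graph) : (F φ f, F φ g) ∈ T.graph := by
  rw [hF.resolvent, ← map_smul, ← map_add, hF.comm φ hφ, (hF.resolvent f g).mp hfg]

theorem isBddMeas_mul_indicator {b : Set ℝ} (hb : MeasurableSet b)
    (hb' : Bornology.IsBounded b) :
    IsBddMeas (fun s : ℝ => (s : ℂ) * b.indicator 1 s) := by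
  obtain ⟨c, hc⟩ := hb'.exists_norm_le
  refine ⟨Complex.measurable_ofReal.mul (measurable_one.indicator hb), max c 0, fun s => ?_⟩
  by_cases hs : s ∈ b
  · simpa [hs] using Or.inl (hc s hs)
  · simp [hs]

theorem ofReal_mul_indicator (b : Set ℝ) :
    (fun s : ℝ => (s : ℂ) * b.indicator 1 s) = b.indicator (fun s => (s : ℂ)) := by
  ext s
  by_cases hs : s ∈ b <;> simp [hs]

/-- The function `1 / (s - z)` on a set at positive distance from `z` gives the resolvent of `T` on
the corresponding spectral subspace. -/
theorem exists_resolvent (hF : IsOperatorCalculus F T t B) {b : Set ℝ} (hb : MeasurableSet b)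
    {z : ℂ} {δ : ℝ} (hδ : 0 < δ) (hz : ∀ s ∈ b, δ ≤ ‖(s : ℂ) - z‖) :
    ∃ R : H →L[ℂ] H, (∀ x, (R x, calcMeasure F b x + z • R x) ∈ T.graph) ∧
      (∀ f g, (f, g) ∈ T.graph → R (g - z • f) = calcMeasure F b f) ∧
      ∀ x, calcMeasure F b (R x) = R x := by
  let φ : ℝ → ℂ := fun s => b.indicator 1 s * ((s : ℂ) - z)⁻¹
  have hφ : IsBddMeas φ := by
    refine ⟨(measurable_one.indicator hb).mul ((Complex.measurable_ofReal.sub_const z).inv),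
      δ⁻¹, fun s => ?_⟩
    by_cases hs : s ∈ b
    · simpa [φ, hs] using inv_anti₀ hδ (hz s hs)
    · simp [φ, hs, hδ.le]
  have hb1 := isBddMeas_indicator_one hb
  have h1 : (fun s : ℝ => (s : ℂ) * φ s) = b.indicator 1 + z • φ := by
    ext s
    by_cases hs : s ∈ b
    · have : (s : ℂ) - z ≠ 0 := norm_pos_iff.mp (hδ.trans_le (hz s hs))
      simp only [φ, hs, Set.indicator_of_mem, Pi.one_apply, one_mul, Pi.add_apply, Pi.smul_apply,
        smul_eq_mul]
      field_simp
      ring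
    · simp [φ, hs]
  have hφ' : IsBddMeas (fun s : ℝ => (s : ℂ) * φ s) := by
    rw [h1]; exact hb1.add (hφ.smul z)
  have h2 : F (fun s : ℝ => (s : ℂ) * φ s) = calcMeasure F b + z • F φ := by
    rw [h1, hF.borel.add _ _ hb1 (hφ.smul z), hF.borel.smul z φ hφ]
    rfl
  refine ⟨F φ, fun x => ?_, fun f g hfg => ?_, fun x => ?_⟩
  · have := hF.mem_graph hφ hφ' x
    rw [h2] at this
    simpa using this
  · rw [map_sub, ← hF.apply_mul hφ hφ' hfg, h2]
    simp
  · have h3 : b.indicator 1 * φ = φ := by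
      ext s
      by_cases hs : s ∈ b <;> simp [φ, hs]
    have h4 := hF.borel.mul _ _ hb1 hφ
    rw [h3] at h4
    conv_rhs => rw [h4]
    rfl

theorem calcMeasure_idem (hF : IsOperatorCalculus F T t B) {b : Set ℝ} (hb : MeasurableSet b)
    (x : H) : calcMeasure F b (calcMeasure F b x) = calcMeasure F b x := by
  have := hF.borel.isSpectralMeasure.inter b b hb hb
  rw [Set.inter_self] at this
  conv_rhs => rw [this]
  rfl

/-- On the spectral subspace of a small ball the operator `T - z` is small, so a ball around a real
point of the resolvent set carries no spectral measure. -/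
theorem exists_ball_eq_zero (hF : IsOperatorCalculus F T t B) {x : ℝ}
    (hx : (x : ℂ) ∈ resolventSet T) : ∃ r > 0, calcMeasure F (Metric.ball x r) = 0 := by
  obtain ⟨R, -, hR⟩ := mem_resolventSet_iff.mp hx
  obtain ⟨C, hC0, hC⟩ := hF.borel.bound
  let r : ℝ := (2 * C * (‖R‖ + 1))⁻¹
  have hr : 0 < r := by positivity
  refine ⟨r, hr, ?_⟩
  have hb : MeasurableSet (Metric.ball x r) := measurableSet_ball
  have hb1 := isBddMeas_indicator_one hb
  have hb2 := isBddMeas_mul_indicator hb Metric.isBounded_ball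
  ext y
  set f := calcMeasure F (Metric.ball x r) y with hf
  have h1 := hF.mem_graph hb1 hb2 f
  have h2 : F ((Metric.ball x r).indicator 1) f = f := hF.calcMeasure_idem hb y
  rw [h2] at h1
  have h3 := hR _ _ h1
  let ψ : ℝ → ℂ := (fun s : ℝ => (s : ℂ) * (Metric.ball x r).indicator 1 s) -
    (x : ℂ) • (Metric.ball x r).indicator 1
  have h4 : F ψ f = F (fun s : ℝ => (s : ℂ) * (Metric.ball x r).indicator 1 s) f - (x : ℂ) • f := by
    rw [hF.borel.sub hb2 (hb1.smul _), hF.borel.smul _ _ hb1]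
    simp [h2]
  have h5 : ‖F ψ‖ ≤ C * r := by
    refine hC ψ r (hb2.sub (hb1.smul _)).1 hr.le fun s => ?_
    by_cases hs : s ∈ Metric.ball x r
    · have : ψ s = ((s - x : ℝ) : ℂ) := by simp [ψ, hs, -Metric.mem_ball]
      rw [this, Complex.norm_real]
      exact (mem_ball_iff_norm.mp hs).le
    · have : ψ s = 0 := by simp [ψ, hs, -Metric.mem_ball]
      rw [this, norm_zero]; exact hr.le
  rw [← h4] at h3
  have h6 : ‖f‖ ≤ (1 / 2) * ‖f‖ := by
    calc ‖f‖ = ‖R (F ψ f)‖ := by rw [h3]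
      _ ≤ ‖R‖ * (‖F ψ‖ * ‖f‖) := (R.le_opNorm _).trans
          (mul_le_mul_of_nonneg_left ((F ψ).le_opNorm _) (norm_nonneg _))
      _ ≤ (‖R‖ + 1) * ((C * r) * ‖f‖) := by gcongr; simp
      _ = (1 / 2) * ‖f‖ := by
        have : C * r * (‖R‖ + 1) = 1 / 2 := by
          simp only [r]; field_simp
        rw [← this]; ring
  have h7 : ‖f‖ = 0 := by
    have := norm_nonneg f
    linarith
  simpa using h7

theorem mem_resolventSet_of_eq_zero (hF : IsOperatorCalculus F T t B) {x r : ℝ} (hr : 0 < r)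
    (h : calcMeasure F (Metric.ball x r) = 0) : (x : ℂ) ∈ resolventSet T := by
  have hb : MeasurableSet (Metric.ball x r) := measurableSet_ball
  have h1 : calcMeasure F (Metric.ball x r)ᶜ = ContinuousLinearMap.id ℂ H := by
    have h2 := hF.borel.isSpectralMeasure.union _ _ hb hb.compl
    rw [Set.union_compl_self, hF.borel.isSpectralMeasure.univ, h] at h2
    simpa using h2.symm
  obtain ⟨R, hR1, hR2, -⟩ := hF.exists_resolvent hb.compl (z := x) hr (fun s hs => by
    rw [← Complex.ofReal_sub, Complex.norm_real]
    simpa [Real.dist_eq] using hs)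
  rw [h1] at hR1 hR2
  exact mem_resolventSet_iff.mpr ⟨R, hR1, hR2⟩

theorem isOpen_resolventSet_real (hF : IsOperatorCalculus F T t B) :
    IsOpen (Complex.ofReal ⁻¹' resolventSet T) := by
  rw [Metric.isOpen_iff]
  intro x hx
  obtain ⟨r, hr, h⟩ := hF.exists_ball_eq_zero hx
  refine ⟨r, hr, fun y hy => ?_⟩
  obtain ⟨δ, hδ, hsub⟩ := Metric.isOpen_iff.mp Metric.isOpen_ball y hy
  refine hF.mem_resolventSet_of_eq_zero hδ ?_
  have h1 := hF.borel.isSpectralMeasure.inter _ _ (measurableSet_ball (x := y) (ε := δ))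
    (measurableSet_ball (x := x) (ε := r))
  rw [Set.inter_eq_left.mpr hsub, h] at h1
  simpa using h1

/-- The real part of the resolvent set is covered by countably many balls without spectral
measure. -/
theorem calcMeasure_resolventSet (hF : IsOperatorCalculus F T t B) :
    calcMeasure F (Complex.ofReal ⁻¹' resolventSet T) = 0 := by
  have hE := hF.borel.isSpectralMeasure
  set U : Set ℝ := Complex.ofReal ⁻¹' resolventSet T
  have hU := hF.isOpen_resolventSet_real
  have h0 : ∀ x : U, ∃ r > 0, calcMeasure F (Metric.ball (x : ℝ) r) = 0 :=
    fun x => hF.exists_ball_eq_zero x.2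
  choose r hr0 hr using h0
  obtain ⟨c, hc, hcover⟩ := TopologicalSpace.isOpen_iUnion_countable
    (fun x : U => Metric.ball (x : ℝ) (r x)) (fun _ => Metric.isOpen_ball)
  have hsub : U ⊆ ⋃ x ∈ c, Metric.ball (x : ℝ) (r x) := by
    rw [hcover]
    exact fun x hx => Set.mem_iUnion.mpr ⟨⟨x, hx⟩, Metric.mem_ball_self (hr0 _)⟩
  have hnull : ∀ b, MeasurableSet b → calcMeasure F b = 0 → ∀ d, MeasurableSet d → d ⊆ b →
      calcMeasure F d = 0 := by
    intro b hb h0 d hd hdb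
    have := hE.inter d b hd hb
    rw [Set.inter_eq_left.mpr hdb, h0] at this
    simpa using this
  rcases c.eq_empty_or_nonempty with rfl | hne
  · have : U = ∅ := by simpa using hsub
    rw [this, hE.empty]
  obtain ⟨e, he⟩ := hc.exists_eq_range hne
  let V : ℕ → Set ℝ := fun n => U ∩ Metric.ball (e n : ℝ) (r (e n))
  have hV : ∀ n, MeasurableSet (V n) := fun n => hU.measurableSet.inter measurableSet_ball
  have hUV : U = ⋃ n, disjointed V n := by
    rw [iUnion_disjointed, ← Set.inter_iUnion]
    refine (Set.inter_eq_left.mpr ?_).symm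
    rw [he] at hsub
    simpa using hsub
  ext f
  have h1 := hE.iUnion (disjointed V) (fun i => MeasurableSet.disjointed hV i)
    (disjoint_disjointed V) f
  rw [← hUV] at h1
  refine h1.unique ?_
  have h2 : ∀ i, calcMeasure F (disjointed V i) = 0 := fun i =>
    hnull _ measurableSet_ball (hr (e i)) _ (MeasurableSet.disjointed hV i)
      ((disjointed_subset V i).trans Set.inter_subset_right)
  simp [h2]

theorem calcMeasure_of_spectrum_subset (hF : IsOperatorCalculus F T t B) {b : Set ℝ}
    (hb : MeasurableSet b) (h : Complex.ofReal ⁻¹' spectrumOp T ⊆ b) :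
    calcMeasure F b = ContinuousLinearMap.id ℂ H := by
  have hE := hF.borel.isSpectralMeasure
  have hU := hF.isOpen_resolventSet_real.measurableSet
  have h1 : b ∪ Complex.ofReal ⁻¹' resolventSet T = Set.univ := by
    rw [Set.eq_univ_iff_forall]
    intro x
    by_cases hx : (x : ℂ) ∈ resolventSet T
    · exact Or.inr hx
    · exact Or.inl (h hx)
  have h2 := hE.union b _ hb hU
  rw [h1, hE.univ, hF.calcMeasure_resolventSet] at h2
  simpa using h2.symm

theorem tendsto_indicator (hF : IsOperatorCalculus F T t B) {b : ℕ → Set ℝ} (hb : Monotone b)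
    (hb' : ∀ n, MeasurableSet (b n)) (x : H) :
    Tendsto (fun n => calcMeasure F (b n) x) atTop (𝓝 (calcMeasure F (⋃ n, b n) x)) := by
  refine hF.borel.tendsto _ _ 1 (fun n => measurable_one.indicator (hb' n))
    (measurable_one.indicator (MeasurableSet.iUnion hb')) (fun n s => ?_) (fun s => ?_) x
  · by_cases hs : s ∈ b n <;> simp [hs]
  · exact (hb.tendsto_indicator b (1 : ℝ → ℂ) s).mono_right (pure_le_nhds _)

/-- The truncated operators converge to `T` on its domain, along every increasing sequence of
bounded Borel sets of full spectral measure. -/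
theorem tendsto_apply (hF : IsOperatorCalculus F T t B) {b : ℕ → Set ℝ} (hb : Monotone b)
    (hb' : ∀ n, MeasurableSet (b n)) (hbd : ∀ n, Bornology.IsBounded (b n))
    (hfull : calcMeasure F (⋃ n, b n) = ContinuousLinearMap.id ℂ H) {f g : H}
    (hfg : (f, g) ∈ T.graph) :
    Tendsto (fun n => F ((b n).indicator fun s => (s : ℂ)) f) atTop (𝓝 g) := by
  have h := hF.tendsto_indicator hb hb' g
  rw [hfull] at h
  refine h.congr fun n => ?_
  rw [← ofReal_mul_indicator, hF.apply_mul (isBddMeas_indicator_one (hb' n))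
    (isBddMeas_mul_indicator (hb' n) (hbd n)) hfg]
  rfl

theorem onReals_eq (F : (ℝ → ℂ) → H →L[ℂ] H) :
    onReals (calcMeasure F) = calcMeasure (fun φ : ℂ → ℂ => F (φ ∘ Complex.ofReal)) := rfl

theorem iUnion_closedBall_real :
    (⋃ n : ℕ, Complex.ofReal ⁻¹' Metric.closedBall 0 (n : ℝ)) = Set.univ := by
  rw [← Set.preimage_iUnion, Metric.iUnion_closedBall_nat, Set.preimage_univ]

theorem monotone_closedBall_real :
    Monotone (fun n : ℕ => Complex.ofReal ⁻¹' Metric.closedBall 0 (n : ℝ)) := fun _ _ h =>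
  Set.preimage_mono (Metric.closedBall_subset_closedBall (Nat.cast_le.mpr h))

theorem isBounded_preimage_ofReal {b : Set ℂ} (hb : Bornology.IsBounded b) :
    Bornology.IsBounded (Complex.ofReal ⁻¹' b) := by
  obtain ⟨c, hc⟩ := hb.exists_norm_le
  exact isBounded_iff_forall_norm_le.mpr ⟨c, fun s hs => by simpa using hc _ hs⟩

theorem isScalarSpectral (hF : IsOperatorCalculus F T t B) :
    IsScalarSpectral T (onReals (calcMeasure F)) where
  dense_domain := by
    intro f
    have h := hF.tendsto_indicator monotone_closedBall_real
      (fun n => Complex.measurable_ofReal Metric.isClosed_closedBall.measurableSet) f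
    rw [iUnion_closedBall_real, hF.borel.isSpectralMeasure.univ] at h
    refine mem_closure_of_tendsto h (Eventually.of_forall fun n => ?_)
    have hb : MeasurableSet (Complex.ofReal ⁻¹' Metric.closedBall 0 (n : ℝ)) :=
      Complex.measurable_ofReal Metric.isClosed_closedBall.measurableSet
    exact (mem_graph_iff_exists.mp (hF.mem_graph (isBddMeas_indicator_one hb)
      (isBddMeas_mul_indicator hb (isBounded_preimage_ofReal Metric.isBounded_closedBall)) f)).1
  closed := hF.resolvent.isClosed
  spectralMeasure := by
    rw [onReals_eq]
    exact (hF.borel.comp Complex.measurable_ofReal).isSpectralMeasure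
  spectrum := hF.calcMeasure_of_spectrum_subset
    hF.isOpen_resolventSet_real.measurableSet.compl subset_rfl
  range_subset b hb hbd f :=
    (mem_graph_iff_exists.mp (hF.mem_graph
      (isBddMeas_indicator_one (Complex.measurable_ofReal hb))
      (isBddMeas_mul_indicator (Complex.measurable_ofReal hb)
        (isBounded_preimage_ofReal hbd)) f)).1
  commute b hb f := mem_graph_iff_exists.mp
    (hF.map_graph (isBddMeas_indicator_one (Complex.measurable_ofReal hb)) (T.mem_graph f))
  restrict_spectrum b hb := by
    intro z hz
    by_contra hzb
    refine hz ?_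
    obtain ⟨δ, hδ, hball⟩ := Metric.isOpen_iff.mp isClosed_closure.isOpen_compl z hzb
    have hdist : ∀ s ∈ Complex.ofReal ⁻¹' b, δ ≤ ‖(s : ℂ) - z‖ := by
      intro s hs
      by_contra hlt
      rw [not_le, ← mem_ball_iff_norm] at hlt
      exact hball hlt (subset_closure hs)
    have hb' : MeasurableSet (Complex.ofReal ⁻¹' b) := Complex.measurable_ofReal hb
    obtain ⟨R, hR1, hR2, hR3⟩ := hF.exists_resolvent hb' hδ hdist
    let E := calcMeasure F (Complex.ofReal ⁻¹' b)
    change z ∈ resolventSet (restrictOp T (LinearMap.range (E : H →ₗ[ℂ] H)))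
    have hE : ∀ x : LinearMap.range (E : H →ₗ[ℂ] H), E x = x := by
      rintro ⟨_, y, rfl⟩
      exact hF.calcMeasure_idem hb' y
    let R' : LinearMap.range (E : H →ₗ[ℂ] H) →L[ℂ] LinearMap.range (E : H →ₗ[ℂ] H) :=
      (R ∘L (LinearMap.range (E : H →ₗ[ℂ] H)).subtypeL).codRestrict _
        fun x => ⟨R x, hR3 x⟩
    refine ⟨R', fun x => ?_, fun u => ?_⟩
    · obtain ⟨h1, h2⟩ := mem_graph_iff_exists.mp (hR1 x)
      have h3 : calcMeasure F (Complex.ofReal ⁻¹' b) (x : H) = x := hE x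
      rw [h3] at h2
      refine ⟨⟨h1, ?_⟩, ?_⟩
      · change T ⟨R x, h1⟩ ∈ _
        rw [h2]
        exact Submodule.add_mem _ x.2 (Submodule.smul_mem _ _ ⟨R x, hR3 x⟩)
      · refine Subtype.ext ?_
        change T ⟨R x, h1⟩ - z • R x = x
        rw [h2, add_sub_cancel_right]
    · obtain ⟨h1, h2⟩ := u.2
      refine Subtype.ext ?_
      change R (T ⟨_, h1⟩ - z • ((u : LinearMap.range (E : H →ₗ[ℂ] H)) : H)) = _
      rw [hR2 _ _ (T.mem_graph ⟨_, h1⟩)]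
      exact hE u
  scalar := by
    let b : ℕ → Set ℝ := fun n => Complex.ofReal ⁻¹' Metric.closedBall 0 (n : ℝ)
    have hb' : ∀ n, MeasurableSet (b n) := fun n =>
      Complex.measurable_ofReal Metric.isClosed_closedBall.measurableSet
    have hbd : ∀ n, Bornology.IsBounded (b n) := fun n =>
      isBounded_preimage_ofReal Metric.isBounded_closedBall
    have hfull : calcMeasure F (⋃ n, b n) = ContinuousLinearMap.id ℂ H := by
      rw [iUnion_closedBall_real, hF.borel.isSpectralMeasure.univ]
    refine ⟨fun n => F ((b n).indicator fun s => (s : ℂ)), fun n => ?_, fun f g => ⟨fun hfg => ?_,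
      fun hlim => ?_⟩⟩
    · have := (hF.borel.comp Complex.measurable_ofReal).hasSpectralIntegral
        (φ := fun z => z) measurable_id (Metric.isClosed_closedBall (x := (0 : ℂ))
          (ε := (n : ℝ))).measurableSet (c := n) (fun z hz => by simpa using hz)
      exact this
    · exact hF.tendsto_apply monotone_closedBall_real hb' hbd hfull hfg
    · have h1 : ∀ n, (calcMeasure F (b n) f, F ((b n).indicator fun s => (s : ℂ)) f) ∈ T.graph := by
        intro n
        have := hF.mem_graph (isBddMeas_indicator_one (hb' n))
          (isBddMeas_mul_indicator (hb' n) (hbd n)) f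
        rwa [ofReal_mul_indicator] at this
      have h2 := hF.tendsto_indicator monotone_closedBall_real hb' f
      rw [iUnion_closedBall_real, hF.borel.isSpectralMeasure.univ] at h2
      exact hF.resolvent.isClosed.mem_of_tendsto (h2.prodMk_nhds hlim) (Eventually.of_forall h1)

/-- The calculus is carried along by a similarity of operators. -/
theorem conj (hF : IsOperatorCalculus F T t B) (V : H ≃L[ℂ] H) {T' : H →ₗ.[ℂ] H}
    (hT' : IsResolventAt T' t ((V : H →L[ℂ] H) ∘L B ∘L (V.symm : H →L[ℂ] H))) :
    IsOperatorCalculus (fun φ => (V : H →L[ℂ] H) ∘L F φ ∘L (V.symm : H →L[ℂ] H)) T' t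
      ((V : H →L[ℂ] H) ∘L B ∘L (V.symm : H →L[ℂ] H)) where
  borel := hF.borel.conj V
  resolvent := hT'
  comm φ hφ x := by simp [hF.comm φ hφ]
  div φ hφ hφ' x := by simp [hF.div φ hφ hφ']

end IsOperatorCalculus

end ScalarSpectral

theorem IsOperatorCalculus.hasSpectralLimit {F : (ℝ → ℂ) → L2 →L[ℂ] L2} {T : L2 →ₗ.[ℂ] L2} {t : ℝ}
    {B : L2 →L[ℂ] L2} (hF : IsOperatorCalculus F T t B) :
    HasSpectralLimit T (calcMeasure F) := by
  intro b hb hb' hbd hsub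
  refine ⟨fun n => F ((b n).indicator fun s => (s : ℂ)), fun n => ?_, fun f => ?_⟩
  · obtain ⟨c, hc⟩ := (hbd n).exists_norm_le
    exact hF.borel.hasSpectralIntegral Complex.measurable_ofReal (hb' n) (c := c)
      (fun s hs => by simpa using hc s hs)
  · exact hF.tendsto_apply hb hb' hbd
      (hF.calcMeasure_of_spectrum_subset (MeasurableSet.iUnion hb') hsub) (T.mem_graph f)

/-! ### Adjoints and selfadjoint resolvents -/

section Adjoint

variable {H : Type*} [NormedAddCommGroup H] [InnerProductSpace ℂ H] [CompleteSpace H]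

theorem denseRange_of_isSelfAdjoint {B : H →L[ℂ] H} (hB : IsSelfAdjoint B)
    (hinj : Function.Injective B) : DenseRange B := by
  have h1 : (LinearMap.range (B : H →ₗ[ℂ] H))ᗮ = ⊥ := by
    rw [Submodule.eq_bot_iff]
    intro x hx
    rw [Submodule.mem_orthogonal] at hx
    refine hinj ?_
    rw [map_zero, ← inner_self_eq_zero (𝕜 := ℂ)]
    have h2 := hx (B (B x)) ⟨B x, rfl⟩
    rw [← hB.adjoint_eq, ContinuousLinearMap.adjoint_inner_left, hB.adjoint_eq] at h2
    exact h2
  have h2 := (Submodule.topologicalClosure_eq_top_iff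
    (K := LinearMap.range (B : H →ₗ[ℂ] H))).mpr h1
  exact (Submodule.dense_iff_topologicalClosure_eq_top).mpr h2

theorem IsResolventAt.adjoint {T : H →ₗ.[ℂ] H} {t : ℝ} {B : H →L[ℂ] H}
    (h : IsResolventAt T t B) (hT : Dense (T.domain : Set H)) :
    IsResolventAt T† t (ContinuousLinearMap.adjoint B) := by
  intro f g
  rw [LinearPMap.adjoint_graph_eq_graph_adjoint hT, Submodule.mem_adjoint_iff]
  constructor
  · intro hfg
    refine ext_inner_left ℂ fun x => ?_
    have h1 := hfg _ _ (h.mem_graph x)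
    rw [ContinuousLinearMap.adjoint_inner_right, inner_add_right, inner_smul_right]
    rw [inner_sub_left, inner_smul_left, Complex.conj_ofReal] at h1
    linear_combination -h1
  · intro hfg a b hab
    have h1 := (h a b).mp hab
    have h2 : ⟪b + (t : ℂ) • a, f⟫_ℂ = ⟪a, g + (t : ℂ) • f⟫_ℂ := by
      conv_lhs => rw [← hfg]
      rw [ContinuousLinearMap.adjoint_inner_right, h1]
    rw [inner_add_left, inner_smul_left, inner_add_right, inner_smul_right,
      Complex.conj_ofReal] at h2
    linear_combination h2

theorem IsResolventAt.isSelfAdjoint {T : H →ₗ.[ℂ] H} {t : ℝ} {B : H →L[ℂ] H}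
    (h : IsResolventAt T t B) (hT : Dense (T.domain : Set H)) (hB : IsSelfAdjoint B) :
    IsSelfAdjoint T := by
  have h1 := h.adjoint hT
  rw [hB.adjoint_eq] at h1
  exact h1.eq h

omit [CompleteSpace H] in
theorem IsResolventAt.dense_domain {T : H →ₗ.[ℂ] H} {t : ℝ} {B : H →L[ℂ] H}
    (h : IsResolventAt T t B) (hB : DenseRange B) : Dense (T.domain : Set H) := by
  refine hB.mono ?_
  rintro _ ⟨x, rfl⟩
  exact (mem_graph_iff_exists.mp (h.mem_graph x)).1

/-- Spectral theorem for the operator `B⁻¹ - t`, where `B` is bounded, selfadjoint and injective: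
it has a Borel functional calculus, whose values at indicators are selfadjoint, and which commutes
with `K = |B|^(1/4)`. -/
theorem exists_isOperatorCalculus {B : H →L[ℂ] H} (hB : IsSelfAdjoint B)
    (hinj : Function.Injective B) (t : ℝ) :
    ∃ (F : (ℝ → ℂ) → H →L[ℂ] H) (K : H →L[ℂ] H),
      (∀ T, IsResolventAt T t B → IsOperatorCalculus F T t B) ∧
      (∀ b, IsSelfAdjoint (calcMeasure F b)) ∧ 0 ≤ K ∧ K ^ 8 = B ^ 2 ∧
      (∀ x, K (B x) = B (K x)) ∧ ∀ φ, IsBddMeas φ → ∀ x, K (F φ x) = F φ (K x) := by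
  let X := spectrum ℂ B
  have hX : CompactSpace X := isCompact_iff_compactSpace.mp (spectrum.isCompact B)
  let Ψ : C(X, ℂ) →⋆ₐ[ℂ] (H →L[ℂ] H) := cfcHom hB.isStarNormal
  have hre : ∀ x : X, ((x : ℂ).re : ℂ) = x := fun x => (hB.mem_spectrum_eq_re x.2).symm
  let ι : C(X, ℂ) := ContinuousMap.restrict (spectrum ℂ B) (ContinuousMap.id ℂ)
  have hι : Ψ ι = B := cfcHom_id hB.isStarNormal
  let g : X → ℝ := fun x => (x : ℂ).re⁻¹ - t
  have hg : Measurable g :=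
    ((Complex.measurable_re.comp measurable_subtype_coe).inv).sub_const t
  let F : (ℝ → ℂ) → H →L[ℂ] H := fun φ => borelExt Ψ (φ ∘ g)
  have hF : IsBorelCalculus F := (isBorelCalculus_borelExt Ψ).comp hg
  let k : C(X, ℂ) := ⟨fun x => ((Real.sqrt (Real.sqrt ‖(x : ℂ)‖) : ℝ) : ℂ), by fun_prop⟩
  let l : C(X, ℂ) := ⟨fun x => ((Real.sqrt (Real.sqrt (Real.sqrt ‖(x : ℂ)‖)) : ℝ) : ℂ), by fun_prop⟩
  have hcomm : ∀ (f : C(X, ℂ)) (φ : X → ℂ), IsBddMeas φ → ∀ x,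
      Ψ f (borelExt Ψ φ x) = borelExt Ψ φ (Ψ f x) := by
    intro f φ hφ x
    have h1 := borelExt_mul Ψ (isBddMeas_continuousMap f) hφ
    have h2 := borelExt_mul Ψ hφ (isBddMeas_continuousMap f)
    rw [mul_comm, h1, borelExt_continuousMap] at h2
    exact congrArg (fun A : H →L[ℂ] H => A x) h2
  refine ⟨F, Ψ k, fun T hT => ⟨hF, hT, fun φ hφ x => ?_, fun φ hφ hφ' x => ?_⟩, fun b => ?_, ?_, ?_,
    fun x => ?_, fun φ hφ x => hcomm k _ (hφ.comp hg) x⟩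
  · conv_lhs => rw [← hι]
    conv_rhs => rw [← hι]
    exact hcomm ι _ (hφ.comp hg) x
  · -- `B` acts as multiplication by `1 / (s + t)`, except at the point `0` of its spectrum, which
    -- carries no spectral measure since `B` is injective
    let N : Set X := {x | (x : ℂ) = 0}
    have hN : MeasurableSet N := measurable_subtype_coe (measurableSet_singleton (0 : ℂ))
    have hN1 := isBddMeas_indicator_one hN
    have hφg := hφ.comp hg
    have hιm := isBddMeas_continuousMap ι
    have h0 : borelExt Ψ (N.indicator 1) = 0 := by
      have h1 : ⇑ι * N.indicator (1 : X → ℂ) = 0 := by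
        ext x
        by_cases hx : x ∈ N
        · have : (x : ℂ) = 0 := hx
          simp [ι, this]
        · simp [hx]
      have h2 := borelExt_continuousMap_mul Ψ ι hN1
      rw [h1, (isBorelCalculus_borelExt Ψ).zero, hι] at h2
      ext y
      refine hinj ?_
      have := congrArg (fun A : H →L[ℂ] H => A y) h2
      simpa using this.symm
    have h1 : ⇑ι * ((fun s : ℝ => ((s : ℂ) + t) * φ s) ∘ g) = φ ∘ g - N.indicator 1 * (φ ∘ g) := by
      ext x
      by_cases hx : x ∈ N
      · have : (x : ℂ) = 0 := hx
        simp [ι, this, hx]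
      · have hx' : (x : ℂ) ≠ 0 := hx
        have h3 : ((g x : ℝ) : ℂ) + t = (x : ℂ)⁻¹ := by
          simp only [g]
          push_cast
          rw [hre x]
          ring
        simp only [Pi.mul_apply, Function.comp_apply, h3, Pi.sub_apply, hx, not_false_eq_true,
          Set.indicator_of_notMem, zero_mul, sub_zero]
        change (x : ℂ) * ((x : ℂ)⁻¹ * φ (g x)) = _
        rw [mul_inv_cancel_left₀ hx']
    have h2 := borelExt_continuousMap_mul Ψ ι (hφ'.comp hg)
    rw [h1, (isBorelCalculus_borelExt Ψ).sub hφg (hN1.mul hφg), borelExt_mul Ψ hN1 hφg, h0,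
      hι] at h2
    have := congrArg (fun A : H →L[ℂ] H => A x) h2
    simpa using this.symm
  · rw [ContinuousLinearMap.isSelfAdjoint_iff']
    by_cases hm : IsBddMeas (b.indicator (1 : ℝ → ℂ) ∘ g)
    · change ContinuousLinearMap.adjoint (borelExt Ψ (b.indicator 1 ∘ g)) = _
      rw [adjoint_borelExt Ψ hm]
      change _ = borelExt Ψ (b.indicator 1 ∘ g)
      congr 1
      ext x
      by_cases hx : g x ∈ b <;> simp [hx]
    · have : calcMeasure F b = 0 := by
        change borelExt Ψ (b.indicator 1 ∘ g) = 0
        rw [borelExt, dif_neg hm]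
      rw [this, map_zero]
  · have h1 : k = star l * l := by
      ext x
      have h2 := Real.mul_self_sqrt (Real.sqrt_nonneg (Real.sqrt ‖(x : ℂ)‖))
      have h3 : star (l x) = l x := Complex.conj_ofReal _
      change (_ : ℂ) = star (l x) * l x
      rw [h3]
      change ((_ : ℝ) : ℂ) = ((_ : ℝ) : ℂ) * ((_ : ℝ) : ℂ)
      rw [← Complex.ofReal_mul, h2]
    rw [h1, map_mul, map_star]
    exact star_mul_self_nonneg _
  · rw [← map_pow, ← hι, ← map_pow]
    congr 1
    ext x
    change ((_ : ℝ) : ℂ) ^ 8 = (x : ℂ) ^ 2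
    rw [show 8 = 2 * (2 * 2) from rfl, pow_mul, pow_mul, ← Complex.ofReal_pow,
      Real.sq_sqrt (Real.sqrt_nonneg _), ← Complex.ofReal_pow, Real.sq_sqrt (norm_nonneg _),
      ← hre x, Complex.norm_real, ← Complex.ofReal_pow, ← Complex.ofReal_pow, Real.norm_eq_abs,
      sq_abs]
  · conv_lhs => rw [← hι]
    conv_rhs => rw [← hι]
    have h1 : Ψ k * Ψ ι = Ψ ι * Ψ k := by rw [← map_mul, mul_comm, map_mul]
    exact congrArg (fun A : H →L[ℂ] H => A x) h1

end Adjoint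

/-! ### Multiplication operators and weak derivatives in `L²(ℝ)` -/

section Multiplication

theorem IsBddMeas.memLp_mul {a : ℝ → ℂ} (ha : IsBddMeas a) (u : L2) :
    MemLp (fun x => a x * u x) 2 volume := by
  obtain ⟨c, hc⟩ := ha.2
  refine (Lp.memLp u).of_le_mul (c := c) (ha.1.aestronglyMeasurable.mul
    (Lp.aestronglyMeasurable u)) (Eventually.of_forall fun x => ?_)
  rw [norm_mul]
  exact mul_le_mul_of_nonneg_right (hc x) (norm_nonneg _)

/-- Multiplication by a bounded measurable function, as a bounded operator in `L²(ℝ)`. -/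
def mulCLM {a : ℝ → ℂ} (ha : IsBddMeas a) : L2 →L[ℂ] L2 :=
  LinearMap.mkContinuousOfExistsBound
    { toFun := fun u => (ha.memLp_mul u).toLp
      map_add' := fun u v => by
        rw [← MemLp.toLp_add]
        refine (MemLp.toLp_eq_toLp_iff _ _).mpr ?_
        filter_upwards [Lp.coeFn_add u v] with x hx
        rw [hx, Pi.add_apply, Pi.add_apply, mul_add]
      map_smul' := fun c u => by
        rw [RingHom.id_apply, ← MemLp.toLp_const_smul]
        refine (MemLp.toLp_eq_toLp_iff _ _).mpr ?_
        filter_upwards [Lp.coeFn_smul c u] with x hx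
        rw [hx, Pi.smul_apply, Pi.smul_apply, smul_eq_mul, smul_eq_mul, mul_left_comm] }
    (by
      obtain ⟨c, hc⟩ := ha.2
      refine ⟨c, fun u => Lp.norm_le_mul_norm_of_ae_le_mul ?_⟩
      filter_upwards [(ha.memLp_mul u).coeFn_toLp] with x hx
      change ‖((ha.memLp_mul u).toLp : L2) x‖ ≤ _
      rw [hx, norm_mul]
      exact mul_le_mul_of_nonneg_right (hc x) (norm_nonneg _))

theorem coeFn_mulCLM {a : ℝ → ℂ} (ha : IsBddMeas a) (u : L2) :
    mulCLM ha u =ᵐ[volume] fun x => a x * u x := (ha.memLp_mul u).coeFn_toLp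

theorem norm_mulCLM_le {a : ℝ → ℂ} (ha : IsBddMeas a) {c : ℝ} (hc0 : 0 ≤ c)
    (hc : ∀ x, ‖a x‖ ≤ c) : ‖mulCLM ha‖ ≤ c := by
  refine ContinuousLinearMap.opNorm_le_bound _ hc0 fun u => Lp.norm_le_mul_norm_of_ae_le_mul ?_
  filter_upwards [coeFn_mulCLM ha u] with x hx
  rw [hx, norm_mul]
  exact mul_le_mul_of_nonneg_right (hc x) (norm_nonneg _)

theorem isSelfAdjoint_mulCLM {a : ℝ → ℂ} (ha : IsBddMeas a)
    (hreal : ∀ x, (starRingEnd ℂ) (a x) = a x) : IsSelfAdjoint (mulCLM ha) := by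
  rw [ContinuousLinearMap.isSelfAdjoint_iff']
  symm
  rw [ContinuousLinearMap.eq_adjoint_iff]
  intro u v
  rw [L2.inner_def, L2.inner_def]
  refine integral_congr_ae ?_
  filter_upwards [coeFn_mulCLM ha u, coeFn_mulCLM ha v] with x hu hv
  rw [hu, hv, RCLike.inner_apply, RCLike.inner_apply, map_mul, hreal]
  ring

end Multiplication

section Derivative

open FourierTransform LineDeriv

theorem derivCLM_eq_lineDerivOp (f : 𝓢'(ℝ, ℂ)) :
    TemperedDistribution.derivCLM ℂ f = ∂_{(1 : ℝ)} f := by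
  ext φ
  rw [TemperedDistribution.derivCLM_apply_apply, TemperedDistribution.lineDerivOp_apply_apply]
  congr 2

theorem fourier_derivCLM_apply (u : L2) (φ : 𝓢(ℝ, ℂ)) :
    𝓕 (TemperedDistribution.derivCLM ℂ (Lp.toTemperedDistribution u)) φ =
      ∫ ξ : ℝ, φ ξ * ((2 * Real.pi * Complex.I * ξ) * (𝓕 u : L2) ξ) := by
  have hg : (fun x : ℝ => ((inner ℝ x 1 : ℝ) : ℂ)).HasTemperateGrowth := by fun_prop
  rw [derivCLM_eq_lineDerivOp, TemperedDistribution.fourier_lineDerivOp_eq,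
    Lp.fourier_toTemperedDistribution_eq]
  change (2 * Real.pi * Complex.I) •
    (TemperedDistribution.smulLeftCLM ℂ (fun x : ℝ => ((inner ℝ x 1 : ℝ) : ℂ))
    (Lp.toTemperedDistribution (𝓕 u : L2)) φ) = _
  rw [TemperedDistribution.smulLeftCLM_apply_apply, Lp.toTemperedDistribution_apply,
    ← integral_smul]
  refine integral_congr_ae (Eventually.of_forall fun ξ => ?_)
  simp only [SchwartzMap.smulLeftCLM_apply_apply hg]
  simp
  ring

/-- On the Fourier side the derivative is multiplication by `2πiξ`. -/
theorem mem_derivGraph_iff {u v : L2} : (u, v) ∈ derivGraph ↔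
    ∀ᵐ ξ : ℝ, (𝓕 v : L2) ξ = (2 * Real.pi * Complex.I * ξ) * (𝓕 u : L2) ξ := by
  have h1 : (u, v) ∈ derivGraph ↔ ∀ φ : 𝓢(ℝ, ℂ),
      ∫ ξ : ℝ, φ ξ * ((2 * Real.pi * Complex.I * ξ) * (𝓕 u : L2) ξ) =
        ∫ ξ : ℝ, φ ξ * (𝓕 v : L2) ξ := by
    change TemperedDistribution.derivCLM ℂ (Lp.toTemperedDistribution u) =
      Lp.toTemperedDistribution v ↔ _
    refine (FourierTransform.fourierEquiv ℂ 𝓢'(ℝ, ℂ)).injective.eq_iff.symm.trans ?_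
    rw [FourierTransform.fourierEquiv_apply, FourierTransform.fourierEquiv_apply,
      Lp.fourier_toTemperedDistribution_eq]
    constructor
    · intro h φ
      rw [← fourier_derivCLM_apply, h, Lp.toTemperedDistribution_apply]
      rfl
    · intro h
      ext φ
      rw [fourier_derivCLM_apply, h, Lp.toTemperedDistribution_apply]
      rfl
  rw [h1]
  constructor
  · intro h
    have hloc : ∀ w : L2, LocallyIntegrable w volume := fun w =>
      (Lp.memLp w).locallyIntegrable (by norm_num)
    refine (ae_eq_of_integral_contDiff_smul_eq
      (f := fun ξ : ℝ => (2 * Real.pi * Complex.I * ξ) * (𝓕 u : L2) ξ) (f' := (𝓕 v : L2))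
      ?_ (hloc _) fun g hg hgc => ?_).mono fun x hx => hx.symm
    · exact (hloc _).continuous_mul (by fun_prop)
    · have hg₁ : HasCompactSupport (Complex.ofRealCLM ∘ g) := hgc.comp_left rfl
      have hg₂ : ContDiff ℝ ((⊤ : ℕ∞) : WithTop ℕ∞) (Complex.ofRealCLM ∘ g) := by fun_prop
      have := h (hg₁.toSchwartzMap hg₂)
      simpa using this
  · intro h φ
    refine integral_congr_ae ?_
    filter_upwards [h] with ξ hξ
    rw [hξ]

/-- The derivative is skew-symmetric. -/
theorem inner_deriv {u u' v v' : L2} (hu : (u, u') ∈ derivGraph) (hv : (v, v') ∈ derivGraph) :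
    ⟪u', v⟫_ℂ = -⟪u, v'⟫_ℂ := by
  rw [← Lp.inner_fourier_eq u' v, ← Lp.inner_fourier_eq u v', L2.inner_def, L2.inner_def,
    ← integral_neg]
  refine integral_congr_ae ?_
  filter_upwards [mem_derivGraph_iff.mp hu, mem_derivGraph_iff.mp hv] with ξ h1 h2
  rw [h1, h2]
  simp only [RCLike.inner_apply, map_mul, Complex.conj_I, Complex.conj_ofReal, map_ofNat]
  ring

/-- A classically differentiable function is weakly differentiable if it and its derivative are
square integrable. -/
theorem toLp_mem_derivGraph {f f' : ℝ → ℂ} (hderiv : ∀ x, HasDerivAt f (f' x) x)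
    (hf : MemLp f 2 volume) (hf' : MemLp f' 2 volume) :
    ((hf.toLp : L2), (hf'.toLp : L2)) ∈ derivGraph := by
  change TemperedDistribution.derivCLM ℂ (Lp.toTemperedDistribution (hf.toLp : L2)) =
    Lp.toTemperedDistribution (hf'.toLp : L2)
  ext φ
  rw [TemperedDistribution.derivCLM_apply_apply, Lp.toTemperedDistribution_apply,
    Lp.toTemperedDistribution_apply]
  have hφ : MemLp φ 2 volume := φ.memLp 2 volume
  have hφ' : MemLp (deriv φ) 2 volume := (SchwartzMap.derivCLM ℂ ℂ φ).memLp 2 volume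
  have h := integral_mul_deriv_eq_deriv_mul_of_integrable (u := f) (v := φ) (u' := f')
    (v' := deriv φ) (fun x _ => hderiv x) (fun x _ => φ.differentiable.differentiableAt.hasDerivAt)
    (hf.integrable_mul hφ') (hf'.integrable_mul hφ) (hf.integrable_mul hφ)
  calc _ = ∫ x, -(f x * deriv φ x) := by
        refine integral_congr_ae ?_
        filter_upwards [hf.coeFn_toLp] with x hx
        rw [hx, neg_apply, SchwartzMap.derivCLM_apply, smul_eq_mul]
        ring
    _ = ∫ x, f' x * φ x := by rw [integral_neg, h, neg_neg]
    _ = _ := by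
        refine integral_congr_ae ?_
        filter_upwards [hf'.coeFn_toLp] with x hx
        rw [hx, smul_eq_mul, mul_comm]

/-- The product rule for a bounded `C¹` function with bounded derivative and a function in the
Sobolev space `H¹`. It is tested against Schwartz functions `φ`, where the factor can be moved to
`φ`. -/
theorem mul_mem_derivGraph {m m' : ℝ → ℝ} (hderiv : ∀ x, HasDerivAt m (m' x) x)
    (hm : IsBddMeas fun x => (m x : ℂ)) (hm' : IsBddMeas fun x => (m' x : ℂ)) {u v : L2}
    (huv : (u, v) ∈ derivGraph) : (mulCLM hm u, mulCLM hm v + mulCLM hm' u) ∈ derivGraph := by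
  change TemperedDistribution.derivCLM ℂ (Lp.toTemperedDistribution (mulCLM hm u)) =
    Lp.toTemperedDistribution (mulCLM hm v + mulCLM hm' u)
  ext φ
  rw [TemperedDistribution.derivCLM_apply_apply, Lp.toTemperedDistribution_apply,
    Lp.toTemperedDistribution_apply]
  have hφ : MemLp φ 2 volume := φ.memLp 2 volume
  have hφ' : MemLp (deriv φ) 2 volume := (SchwartzMap.derivCLM ℂ ℂ φ).memLp 2 volume
  let w : ℝ → ℂ := fun x => (m x : ℂ) * star (φ x)
  let w' : ℝ → ℂ := fun x => (m' x : ℂ) * star (φ x) + (m x : ℂ) * star (deriv φ x)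
  have hw : ∀ x, HasDerivAt w (w' x) x := fun x =>
    (hderiv x).ofReal_comp.mul
      (φ.differentiable.differentiableAt (x := x)).hasDerivAt.star
  have hmul : ∀ {a : ℝ → ℂ} {f : ℝ → ℂ}, IsBddMeas a → MemLp f 2 volume →
      MemLp (fun x => a x * star (f x)) 2 volume := by
    intro a f ha hf
    obtain ⟨c, hc⟩ := ha.2
    refine hf.of_le_mul (c := c) (ha.1.aestronglyMeasurable.mul
      (continuous_star.comp_aestronglyMeasurable hf.1)) (Eventually.of_forall fun x => ?_)
    rw [norm_mul, norm_star]
    exact mul_le_mul_of_nonneg_right (hc x) (norm_nonneg _)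
  have hwL : MemLp w 2 volume := hmul hm hφ
  have hwL' : MemLp w' 2 volume := (hmul hm' hφ).add (hmul hm hφ')
  have h := inner_deriv (toLp_mem_derivGraph hw hwL hwL') huv
  rw [L2.inner_def, L2.inner_def] at h
  have h1 : Integrable (fun x => φ x * ((m' x : ℂ) * u x)) volume :=
    hφ.integrable_mul (hm'.memLp_mul u)
  have h2 : Integrable (fun x => deriv φ x * ((m x : ℂ) * u x)) volume :=
    hφ'.integrable_mul (hm.memLp_mul u)
  have h3 : Integrable (fun x => φ x * ((m x : ℂ) * v x)) volume :=
    hφ.integrable_mul (hm.memLp_mul v)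
  have h4 : ∫ x, (φ x * ((m' x : ℂ) * u x) + deriv φ x * ((m x : ℂ) * u x)) =
      -∫ x, φ x * ((m x : ℂ) * v x) := by
    calc _ = _ := integral_congr_ae (by
          filter_upwards [hwL'.coeFn_toLp] with x hx
          rw [hx, RCLike.inner_apply]
          simp [w']
          ring)
      _ = _ := h
      _ = _ := congrArg Neg.neg (integral_congr_ae (by
          filter_upwards [hwL.coeFn_toLp] with x hx
          rw [hx, RCLike.inner_apply]
          simp [w]
          ring))
  rw [integral_add h1 h2] at h4
  calc _ = -∫ x, deriv φ x * ((m x : ℂ) * u x) := by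
        rw [← integral_neg]
        refine integral_congr_ae ?_
        filter_upwards [coeFn_mulCLM hm u] with x hx
        rw [hx, neg_apply, SchwartzMap.derivCLM_apply, smul_eq_mul]
        ring
    _ = ∫ x, (φ x * ((m x : ℂ) * v x) + φ x * ((m' x : ℂ) * u x)) := by
        rw [integral_add h3 h1]
        linear_combination -h4
    _ = _ := by
        refine integral_congr_ae ?_
        filter_upwards [coeFn_mulCLM hm v, coeFn_mulCLM hm' u,
          Lp.coeFn_add (mulCLM hm v) (mulCLM hm' u)] with x h5 h6 h7
        rw [h7, Pi.add_apply, h5, h6, smul_eq_mul]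
        ring

theorem isClosed_derivGraph : IsClosed (derivGraph : Set (L2 × L2)) := by
  have h : (derivGraph : Set (L2 × L2)) = {p : L2 × L2 | TemperedDistribution.derivCLM ℂ
      (Lp.toTemperedDistributionCLM ℂ (volume : Measure ℝ) 2 p.1) =
      Lp.toTemperedDistributionCLM ℂ (volume : Measure ℝ) 2 p.2} := rfl
  rw [h]
  exact isClosed_eq (by fun_prop) (by fun_prop)

theorem isBddMeas_bessel {s : ℝ} (hs : 0 < s) :
    IsBddMeas (fun ξ : ℝ => (((4 * Real.pi ^ 2 * ξ ^ 2 + s)⁻¹ : ℝ) : ℂ)) ∧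
    ∀ ξ : ℝ, ‖(((4 * Real.pi ^ 2 * ξ ^ 2 + s)⁻¹ : ℝ) : ℂ)‖ ≤ s⁻¹ := by
  have h : ∀ ξ : ℝ, ‖(((4 * Real.pi ^ 2 * ξ ^ 2 + s)⁻¹ : ℝ) : ℂ)‖ ≤ s⁻¹ := by
    intro ξ
    rw [Complex.norm_real, Real.norm_of_nonneg (by positivity)]
    exact inv_anti₀ hs (le_add_of_nonneg_left (by positivity))
  exact ⟨⟨by fun_prop, s⁻¹, h⟩, h⟩

/-- For `s > 0` the operator `-D² + s` has a bounded inverse of norm at most `1 / s`, which is a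
Fourier multiplier. -/
theorem exists_free_resolvent {s : ℝ} (hs : 0 < s) : ∃ G : L2 →L[ℂ] L2, ‖G‖ ≤ s⁻¹ ∧
    (∀ x, ∃ v w, (G x, v) ∈ derivGraph ∧ (v, w) ∈ derivGraph ∧ -w + (s : ℂ) • G x = x) ∧
    ∀ u v w, (u, v) ∈ derivGraph → (v, w) ∈ derivGraph → G (-w + (s : ℂ) • u) = u := by
  obtain ⟨hb, hbound⟩ := isBddMeas_bessel hs
  let 𝓕L : L2 ≃ₗᵢ[ℂ] L2 := Lp.fourierTransformₗᵢ ℝ ℂ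
  let M := mulCLM hb
  let G : L2 →L[ℂ] L2 := (𝓕L.symm.toContinuousLinearEquiv : L2 →L[ℂ] L2) ∘L M ∘L
    (𝓕L.toContinuousLinearEquiv : L2 →L[ℂ] L2)
  have hG : ∀ x, 𝓕 (G x) = M (𝓕 x) := fun x => 𝓕L.apply_symm_apply _
  have hpos : ∀ ξ : ℝ, (4 * Real.pi ^ 2 * ξ ^ 2 + s : ℝ) ≠ 0 := fun ξ => by positivity
  have hposC : ∀ ξ : ℝ, (4 * Real.pi ^ 2 * (ξ : ℂ) ^ 2 + s : ℂ) ≠ 0 := fun ξ => by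
    exact_mod_cast hpos ξ
  have hinv : ∀ u v w, (u, v) ∈ derivGraph → (v, w) ∈ derivGraph →
      G (-w + (s : ℂ) • u) = u := by
    intro u v w huv hvw
    refine 𝓕L.injective ?_
    change 𝓕 (G (-w + (s : ℂ) • u)) = 𝓕 u
    rw [hG]
    have h0 : (𝓕 (-w + (s : ℂ) • u) : L2) = -𝓕 w + (s : ℂ) • 𝓕 u := by
      change 𝓕L _ = -𝓕L w + (s : ℂ) • 𝓕L u
      rw [map_add, map_neg, map_smul]
    rw [h0]
    refine Lp.ext ?_
    filter_upwards [coeFn_mulCLM hb (-𝓕 w + (s : ℂ) • 𝓕 u), Lp.coeFn_add (-𝓕 w) ((s : ℂ) • 𝓕 u),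
      Lp.coeFn_neg (𝓕 w : L2), Lp.coeFn_smul (s : ℂ) (𝓕 u : L2), mem_derivGraph_iff.mp huv,
      mem_derivGraph_iff.mp hvw] with ξ h1 h2 h3 h4 h5 h6
    rw [h1, h2, Pi.add_apply, h3, Pi.neg_apply, h4, Pi.smul_apply, h6, h5, smul_eq_mul]
    have h7 := hposC ξ
    push_cast
    field_simp
    linear_combination (-4 * (Real.pi : ℂ) ^ 2 * ξ ^ 2 * (𝓕 u : L2) ξ) * Complex.I_sq
  refine ⟨G, ?_, fun x => ?_, hinv⟩
  · refine ContinuousLinearMap.opNorm_le_bound _ (by positivity) fun x => ?_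
    rw [← Lp.norm_fourier_eq (G x), hG, ← Lp.norm_fourier_eq x]
    exact (M.le_opNorm _).trans
      (mul_le_mul_of_nonneg_right (norm_mulCLM_le hb (by positivity) hbound) (norm_nonneg _))
  · have hb1 : IsBddMeas (fun ξ : ℝ => (2 * Real.pi * Complex.I * ξ) *
        (((4 * Real.pi ^ 2 * ξ ^ 2 + s)⁻¹ : ℝ) : ℂ)) := by
      refine ⟨by fun_prop, 1 + s⁻¹, fun ξ => ?_⟩
      rw [norm_mul, Complex.norm_real, Real.norm_of_nonneg (inv_nonneg.mpr (by positivity))]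
      have h1 : ‖(2 * Real.pi * Complex.I * ξ : ℂ)‖ = |2 * Real.pi * ξ| := by
        rw [← Real.norm_eq_abs, ← Complex.norm_real]
        simp
      rw [h1, ← div_eq_mul_inv, div_le_iff₀ (by positivity)]
      have h2 : (2 * Real.pi * ξ) ^ 2 = 4 * Real.pi ^ 2 * ξ ^ 2 := by ring
      rw [← h2, ← sq_abs]
      have h3 : s⁻¹ * s = 1 := inv_mul_cancel₀ hs.ne'
      have h4 : 0 ≤ s⁻¹ * |2 * Real.pi * ξ| ^ 2 := by positivity
      nlinarith [sq_nonneg (|2 * Real.pi * ξ| - 1), abs_nonneg (2 * Real.pi * ξ)]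
    let v : L2 := 𝓕L.symm (mulCLM hb1 (𝓕 x))
    let w : L2 := (s : ℂ) • G x - x
    have hv : (𝓕 v : L2) = mulCLM hb1 (𝓕 x) := 𝓕L.apply_symm_apply _
    have hw : (𝓕 w : L2) = (s : ℂ) • M (𝓕 x) - 𝓕 x := by
      rw [← hG]
      change 𝓕L _ = (s : ℂ) • 𝓕L (G x) - 𝓕L x
      rw [← map_smul, ← map_sub]
    refine ⟨v, w, mem_derivGraph_iff.mpr ?_, mem_derivGraph_iff.mpr ?_, by simp [w]⟩
    · rw [hv, hG]
      filter_upwards [coeFn_mulCLM hb1 (𝓕 x), coeFn_mulCLM hb (𝓕 x)] with ξ h1 h2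
      rw [h1, h2]
      ring
    · rw [hv, hw]
      filter_upwards [coeFn_mulCLM hb1 (𝓕 x), coeFn_mulCLM hb (𝓕 x),
        Lp.coeFn_sub ((s : ℂ) • M (𝓕 x)) (𝓕 x), Lp.coeFn_smul (s : ℂ) (M (𝓕 x))] with ξ h1 h2 h3 h4
      rw [h3, Pi.sub_apply, h4, Pi.smul_apply, h1, h2, smul_eq_mul]
      have h7 := hposC ξ
      push_cast
      field_simp
      linear_combination (-4 * (Real.pi : ℂ) ^ 2 * ξ ^ 2 * (𝓕 x : L2) ξ) * Complex.I_sq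

end Derivative

/-! ### Schrödinger operators -/

section Potentials

/-- A function that is the integral of its derivative is bounded if the derivative is integrable.
The weight `1 + |x|³` serves only as a majorant of `1`. -/
theorem exists_abs_le_of_integrable_deriv {f : ℝ → ℝ}
    (hf : ∀ a b, ∫ x in a..b, deriv f x = f b - f a)
    (hint : Integrable (fun x => (1 + |x| ^ 3) * |deriv f x|) volume) :
    ∃ c : ℝ, ∀ x, |f x| ≤ c := by
  have h1 : Integrable (deriv f) volume := by
    refine hint.mono (measurable_deriv f).aestronglyMeasurable (Eventually.of_forall fun x => ?_)
    rw [Real.norm_eq_abs, Real.norm_of_nonneg (by positivity)]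
    exact le_mul_of_one_le_left (abs_nonneg _) (le_add_of_nonneg_right (by positivity))
  refine ⟨|f 0| + ∫ x, ‖deriv f x‖, fun x => ?_⟩
  have h2 : f x = f 0 + ∫ y in (0 : ℝ)..x, deriv f y := by rw [hf]; ring
  rw [h2]
  refine (abs_add_le _ _).trans (add_le_add le_rfl ?_)
  rw [← Real.norm_eq_abs]
  exact intervalIntegral.norm_integral_le_integral_norm_uIoc.trans
    (setIntegral_le_integral h1.norm (Eventually.of_forall fun _ => norm_nonneg _))

theorem IsAdmissible.exists_abs_le {q : ℝ → ℝ} (hq : IsAdmissible q) :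
    ∃ c : ℝ, ∀ x, |q x| ≤ c := by
  have hd := hq.contDiff.continuous_deriv le_rfl
  refine exists_abs_le_of_integrable_deriv (fun a b => ?_) ?_
  · exact intervalIntegral.integral_deriv_eq_sub
      (fun x _ => hq.contDiff.differentiable one_ne_zero x) (hd.intervalIntegrable a b)
  · simpa only [iteratedDeriv_one] using hq.integrable 1 one_le_two

/-- The absolute continuity of `q'` enters here, through the fundamental theorem of calculus. -/
theorem IsAdmissible.exists_abs_deriv_le {q : ℝ → ℝ} (hq : IsAdmissible q) :
    ∃ c : ℝ, ∀ x, |deriv q x| ≤ c := by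
  refine exists_abs_le_of_integrable_deriv
    (fun a b => (hq.absCont a b).integral_deriv_eq_sub) ?_
  simpa only [iteratedDeriv_succ, iteratedDeriv_zero] using hq.integrable 2 le_rfl

end Potentials

section Graphs

theorem mem_graph_prodOp {H : Type*} [NormedAddCommGroup H] [NormedSpace ℂ H]
    {A B : H →ₗ.[ℂ] H} {x z : H} :
    (x, z) ∈ (prodOp B A).graph ↔ ∃ y, (x, y) ∈ A.graph ∧ (y, z) ∈ B.graph := by
  simp only [mem_graph_iff_exists]
  constructor
  · rintro ⟨⟨h1, h2⟩, h3⟩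
    exact ⟨A ⟨x, h1⟩, ⟨h1, rfl⟩, h2, h3⟩
  · rintro ⟨y, ⟨h1, rfl⟩, h2, h3⟩
    exact ⟨⟨h1, h2⟩, h3⟩

theorem graph_derivOp : derivOp.graph = derivGraph :=
  Submodule.toLinearPMap_graph_eq _ fun p hp h0 => derivGraph_snd_eq_zero p hp h0

theorem derivGraph_snd_unique {u v w : L2} (h₁ : (u, v) ∈ derivGraph)
    (h₂ : (u, w) ∈ derivGraph) : v = w := by
  rw [← graph_derivOp] at h₁ h₂
  exact derivOp.mem_graph_snd_inj h₁ h₂ rfl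

theorem add_mem_derivGraph {u v u' v' : L2} (h₁ : (u, v) ∈ derivGraph)
    (h₂ : (u', v') ∈ derivGraph) : (u + u', v + v') ∈ derivGraph := by
  have := add_mem h₁ h₂
  rwa [Prod.mk_add_mk] at this

theorem smul_mem_derivGraph {u v : L2} (c : ℂ) (h₁ : (u, v) ∈ derivGraph) :
    (c • u, c • v) ∈ derivGraph := by
  have := derivGraph.smul_mem c h₁
  rwa [Prod.smul_mk] at this

theorem mem_graph_schrodingerOp {h : ℝ} {q : ℝ → ℝ}
    (hV : IsBddMeas fun x => ((q x + h : ℝ) : ℂ)) {f g : L2} :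
    (f, g) ∈ (schrodingerOp h q).graph ↔ ∃ f' f'', (f, f') ∈ derivGraph ∧ (f', f'') ∈ derivGraph ∧
      g = -f'' + mulCLM hV f := by
  have hD : ∀ u w, (u, w) ∈ (prodOp derivOp derivOp).graph ↔
      ∃ v, (u, v) ∈ derivGraph ∧ (v, w) ∈ derivGraph := by
    intro u w
    rw [mem_graph_prodOp, graph_derivOp]
  constructor
  · intro hfg
    obtain ⟨⟨h1, h2⟩, h3⟩ := mem_graph_iff_exists.mp hfg
    obtain ⟨f', h4, h5⟩ := (hD _ _).mp ((prodOp derivOp derivOp).mem_graph ⟨f, h1⟩)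
    exact ⟨f', _, h4, h5, h3.symm⟩
  · rintro ⟨f', f'', h1, h2, rfl⟩
    obtain ⟨h3, h4⟩ := mem_graph_iff_exists.mp ((hD _ _).mpr ⟨f', h1, h2⟩)
    refine mem_graph_iff_exists.mpr ⟨⟨h3, hV.memLp_mul f⟩, ?_⟩
    rw [← h4]
    rfl

end Graphs

section Resolvents

variable {H : Type*} [NormedAddCommGroup H] [NormedSpace ℂ H]

/-- The Neumann series. -/
theorem exists_inverse_one_sub [CompleteSpace H] {A : H →L[ℂ] H} (hA : ‖A‖ < 1) :
    ∃ U : H →L[ℂ] H, (∀ x, U (x - A x) = x) ∧ ∀ x, U x - A (U x) = x := by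
  obtain ⟨u, hu⟩ := isUnit_one_sub_of_norm_lt_one hA
  refine ⟨(u⁻¹ : (H →L[ℂ] H)ˣ), fun x => ?_, fun x => ?_⟩
  · have := congrArg (fun B : H →L[ℂ] H => B x) u.inv_mul
    rw [hu] at this
    exact this
  · have := congrArg (fun B : H →L[ℂ] H => B x) u.mul_inv
    rw [hu] at this
    exact this

/-- Moving the base point of a resolvent by a Neumann series. -/
theorem IsResolventAt.shift [CompleteSpace H] {T : H →ₗ.[ℂ] H} {t : ℝ} {R : H →L[ℂ] H}
    (h : IsResolventAt T t R) {t' : ℝ} (ht : |t - t'| * ‖R‖ < 1) :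
    ∃ R' : H →L[ℂ] H, IsResolventAt T t' R' := by
  have h1 : ‖((t - t' : ℝ) : ℂ) • R‖ < 1 := by
    rwa [norm_smul, Complex.norm_real]
  obtain ⟨U, hU1, hU2⟩ := exists_inverse_one_sub h1
  refine ⟨U ∘L R, fun f g => ?_⟩
  have h2 : ∀ f g, R (g + (t : ℂ) • f) =
      R (g + (t' : ℂ) • f) + (((t - t' : ℝ) : ℂ) • R) f := by
    intro f g
    rw [smul_apply, ← map_smul, ← map_add]
    congr 1
    rw [add_assoc, ← add_smul]
    congr 2
    push_cast
    ring
  rw [h f g, h2]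
  constructor
  · intro h3
    rw [ContinuousLinearMap.comp_apply, eq_sub_of_add_eq h3, hU1]
  · intro h3
    have h4 := hU2 (R (g + (t' : ℂ) • f))
    change U (R _) = f at h3
    rw [h3] at h4
    rw [← h4, sub_add_cancel]

theorem IsResolventAt.injective {T : H →ₗ.[ℂ] H} {t : ℝ} {R : H →L[ℂ] H}
    (h : IsResolventAt T t R) : Function.Injective R := by
  rw [injective_iff_map_eq_zero]
  intro x hx
  have h1 := h.mem_graph x
  rw [hx, smul_zero, sub_zero] at h1
  exact T.graph_fst_eq_zero_snd h1 rfl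

end Resolvents

section Schrodinger

variable {h : ℝ} {q : ℝ → ℝ}

/-- Perturbation of the free resolvent by the bounded potential, far enough to the left. -/
theorem exists_isResolventAt_schrodingerOp (hV : IsBddMeas fun x => ((q x + h : ℝ) : ℂ)) :
    ∃ s > 0, ∃ R : L2 →L[ℂ] L2, IsResolventAt (schrodingerOp h q) s R := by
  let V := mulCLM hV
  let s : ℝ := ‖V‖ + 1
  have hs : 0 < s := by positivity
  obtain ⟨G, hGn, hG1, hG2⟩ := exists_free_resolvent hs
  have hn : ‖-(V ∘L G)‖ < 1 := by
    rw [norm_neg]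
    calc ‖V ∘L G‖ ≤ ‖V‖ * s⁻¹ := (ContinuousLinearMap.opNorm_comp_le _ _).trans
          (mul_le_mul_of_nonneg_left hGn (norm_nonneg _))
      _ < 1 := by
          rw [← div_eq_mul_inv, div_lt_one hs]
          simp [s]
  obtain ⟨U, hU1, hU2⟩ := exists_inverse_one_sub hn
  refine ⟨s, hs, G ∘L U, fun f g => ?_⟩
  rw [mem_graph_schrodingerOp hV, ContinuousLinearMap.comp_apply]
  constructor
  · rintro ⟨f', f'', h1, h2, rfl⟩
    have h3 := hG2 f f' f'' h1 h2
    have h4 := hU1 (-f'' + (s : ℂ) • f)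
    have h5 : (-(V ∘L G)) (-f'' + (s : ℂ) • f) = -V f := by
      rw [neg_apply, ContinuousLinearMap.comp_apply, h3]
    rw [h5] at h4
    have h6 : -f'' + mulCLM hV f + (s : ℂ) • f = -f'' + (s : ℂ) • f - -V f := by
      simp only [V]; abel
    rw [h6, h4, h3]
  · intro h1
    obtain ⟨f', f'', h2, h3, h4⟩ := hG1 (U (g + (s : ℂ) • f))
    rw [h1] at h2 h4
    refine ⟨f', f'', h2, h3, ?_⟩
    have h5 := hU2 (g + (s : ℂ) • f)
    rw [neg_apply, ContinuousLinearMap.comp_apply, h1, ← h4] at h5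
    have h6 : g + (s : ℂ) • f = (-f'' + mulCLM hV f) + (s : ℂ) • f := by
      rw [← h5]; simp only [V]; abel
    exact add_right_cancel h6

/-- The form identity `⟪v, (-D² + V) f⟫ = ⟪v', f'⟫ + ⟪v, V f⟫`. -/
theorem inner_schrodingerOp (hV : IsBddMeas fun x => ((q x + h : ℝ) : ℂ)) {v v' f f' g : L2}
    (hv : (v, v') ∈ derivGraph) (hf : (f, f') ∈ derivGraph)
    (hfg : (f, g) ∈ (schrodingerOp h q).graph) :
    ⟪v, g⟫_ℂ = ⟪v', f'⟫_ℂ + ⟪v, mulCLM hV f⟫_ℂ := by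
  obtain ⟨f₁, f'', h1, h2, rfl⟩ := (mem_graph_schrodingerOp hV).mp hfg
  obtain rfl := derivGraph_snd_unique hf h1
  rw [inner_add_right, inner_neg_right, inner_deriv hv h2]

theorem isSelfAdjoint_mulCLM_ofReal {V : ℝ → ℝ} (hV : IsBddMeas fun x => (V x : ℂ)) :
    IsSelfAdjoint (mulCLM hV) :=
  isSelfAdjoint_mulCLM hV fun _ => Complex.conj_ofReal _

theorem inner_schrodingerOp_symm (hV : IsBddMeas fun x => ((q x + h : ℝ) : ℂ)) {f g u w : L2}
    (hfg : (f, g) ∈ (schrodingerOp h q).graph) (huw : (u, w) ∈ (schrodingerOp h q).graph) :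
    ⟪g, u⟫_ℂ = ⟪f, w⟫_ℂ := by
  obtain ⟨f', _, h1, -, -⟩ := (mem_graph_schrodingerOp hV).mp hfg
  obtain ⟨u', _, h2, -, -⟩ := (mem_graph_schrodingerOp hV).mp huw
  rw [inner_schrodingerOp hV h1 h2 huw, ← inner_conj_symm, inner_schrodingerOp hV h2 h1 hfg,
    map_add, inner_conj_symm, inner_conj_symm]
  congr 1
  exact ContinuousLinearMap.isSelfAdjoint_iff_isSymmetric.mp
    (isSelfAdjoint_mulCLM_ofReal hV) f u

/-- A Schrödinger operator with a positive lower bound has a bounded positive inverse. -/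
theorem exists_inverse_schrodingerOp (hV : IsBddMeas fun x => ((q x + h : ℝ) : ℂ)) {c : ℝ}
    (hc : 0 < c) (hpos : ∀ f g, (f, g) ∈ (schrodingerOp h q).graph →
      c * ‖f‖ ^ 2 ≤ (⟪g, f⟫_ℂ).re) :
    ∃ A : L2 →L[ℂ] L2, IsResolventAt (schrodingerOp h q) 0 A ∧ 0 ≤ A := by
  obtain ⟨s, hs, R, hR⟩ := exists_isResolventAt_schrodingerOp hV
  have hRn : ‖R‖ ≤ (c + s)⁻¹ := by
    refine ContinuousLinearMap.opNorm_le_bound _ (by positivity) fun x => ?_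
    have h1 := hpos _ _ (hR.mem_graph x)
    rw [inner_sub_left, inner_smul_left, inner_self_eq_norm_sq_to_K, Complex.conj_ofReal,
      Complex.sub_re] at h1
    have h2 : ((s : ℂ) * ((‖R x‖ : ℝ) : ℂ) ^ 2).re = s * ‖R x‖ ^ 2 := by
      rw [← Complex.ofReal_pow, ← Complex.ofReal_mul, Complex.ofReal_re]
    have h3 : (⟪x, R x⟫_ℂ).re ≤ ‖x‖ * ‖R x‖ := re_inner_le_norm (𝕜 := ℂ) x (R x)
    have h4 : c * ‖R x‖ ^ 2 ≤ (⟪x, R x⟫_ℂ).re - s * ‖R x‖ ^ 2 := by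
      rw [← h2]; exact h1
    rw [inv_mul_eq_div, le_div_iff₀ (by positivity)]
    rcases (norm_nonneg (R x)).eq_or_lt with h5 | h5
    · rw [← h5]; simp
    · nlinarith
  obtain ⟨A, hA⟩ := hR.shift (t' := 0) (by
    rw [sub_zero, abs_of_pos hs]
    calc s * ‖R‖ ≤ s * (c + s)⁻¹ := mul_le_mul_of_nonneg_left hRn hs.le
      _ < 1 := by
        rw [← div_eq_mul_inv, div_lt_one (by positivity)]
        linarith)
  have hmem : ∀ x, (A x, x) ∈ (schrodingerOp h q).graph := fun x => by
    simpa using hA.mem_graph x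
  refine ⟨A, hA, ?_⟩
  rw [ContinuousLinearMap.nonneg_iff_isPositive, ContinuousLinearMap.isPositive_def]
  refine ⟨fun x y => ?_, fun x => ?_⟩
  · exact (inner_schrodingerOp_symm hV (hmem x) (hmem y)).symm
  · have h1 := hpos _ _ (hmem x)
    have h2 : 0 ≤ (⟪x, A x⟫_ℂ).re := le_trans (by positivity) h1
    rw [ContinuousLinearMap.reApplyInnerSelf_apply, inner_re_symm]
    exact h2

/-- Let `R = A^(1/2)`, where `A` is the inverse of a positive Schrödinger operator. The range of
`R`, the form domain of the operator, is the Sobolev space `H¹`, hence it is invariant under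
multiplication by a bounded `C¹` function with bounded derivative. -/
theorem exists_mulCLM_sqrt_eq (hV : IsBddMeas fun x => ((q x + h : ℝ) : ℂ)) {R : L2 →L[ℂ] L2}
    (hR : IsSelfAdjoint R) (hA : IsResolventAt (schrodingerOp h q) 0 (R ∘L R))
    {m m' : ℝ → ℝ} (hderiv : ∀ x, HasDerivAt m (m' x) x)
    (hm : IsBddMeas fun x => (m x : ℂ)) (hm' : IsBddMeas fun x => (m' x : ℂ)) :
    ∃ N : L2 →L[ℂ] L2, ∀ x, mulCLM hm (R x) = R (N x) := by
  have hinj : Function.Injective R := Function.Injective.of_comp (f := R) hA.injective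
  have hdense := denseRange_of_isSelfAdjoint hR hinj
  have hsymm : ∀ x y, ⟪R x, y⟫_ℂ = ⟪x, R y⟫_ℂ :=
    ContinuousLinearMap.isSelfAdjoint_iff_isSymmetric.mp hR
  let V := mulCLM hV
  have hmem : ∀ x, (R (R x), x) ∈ (schrodingerOp h q).graph := fun x => by
    simpa using hA.mem_graph x
  have hdom : ∀ x, ∃ y, (R (R x), y) ∈ derivGraph := fun x => by
    obtain ⟨f', _, h1, -⟩ := (mem_graph_schrodingerOp hV).mp (hmem x)
    exact ⟨f', h1⟩
  choose d hd using hdom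
  let dL : L2 →ₗ[ℂ] L2 :=
    { toFun := d
      map_add' := fun x y => derivGraph_snd_unique (hd (x + y)) (by
        rw [map_add, map_add]; exact add_mem_derivGraph (hd x) (hd y))
      map_smul' := fun c x => derivGraph_snd_unique (hd (c • x)) (by
        rw [map_smul, map_smul]; exact smul_mem_derivGraph c (hd x)) }
  -- `‖(R² x)'‖² = ⟪R² x, x⟫ - ⟪R² x, V R² x⟫` is controlled by `‖R x‖²`
  have hbound : ∀ x, ‖dL x‖ ≤ Real.sqrt (1 + ‖V‖ * ‖R‖ ^ 2) * ‖(R : L2 →ₗ[ℂ] L2) x‖ := by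
    intro x
    have h1 := inner_schrodingerOp hV (hd x) (hd x) (hmem x)
    have h2 : ‖d x‖ ^ 2 = ‖R x‖ ^ 2 - (⟪R (R x), V (R (R x))⟫_ℂ).re := by
      rw [hsymm, inner_self_eq_norm_sq_to_K, inner_self_eq_norm_sq_to_K] at h1
      have h3 := congrArg Complex.re h1
      rw [Complex.add_re] at h3
      have h4 : ∀ r : ℝ, ((r : ℂ) ^ 2).re = r ^ 2 := fun r => by
        rw [← Complex.ofReal_pow, Complex.ofReal_re]
      have h5 : ‖R x‖ ^ 2 = ‖d x‖ ^ 2 + (⟪R (R x), V (R (R x))⟫_ℂ).re := by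
        rw [← h4, ← h4]; exact h3
      linarith
    have h3 : -(⟪R (R x), V (R (R x))⟫_ℂ).re ≤ ‖V‖ * ‖R‖ ^ 2 * ‖R x‖ ^ 2 := by
      have h4 : ‖⟪R (R x), V (R (R x))⟫_ℂ‖ ≤ ‖R (R x)‖ * ‖V (R (R x))‖ := norm_inner_le_norm _ _
      have h5 := Complex.abs_re_le_norm (⟪R (R x), V (R (R x))⟫_ℂ)
      have h6 := V.le_opNorm (R (R x))
      have h7 := R.le_opNorm (R x)
      calc _ ≤ |(⟪R (R x), V (R (R x))⟫_ℂ).re| := neg_le_abs _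
        _ ≤ ‖R (R x)‖ * (‖V‖ * ‖R (R x)‖) :=
          (h5.trans h4).trans (mul_le_mul_of_nonneg_left h6 (norm_nonneg _))
        _ ≤ (‖R‖ * ‖R x‖) * (‖V‖ * (‖R‖ * ‖R x‖)) := by gcongr
        _ = _ := by ring
    change ‖d x‖ ≤ _ * ‖R x‖
    rw [← Real.sqrt_sq (norm_nonneg (R x)), ← Real.sqrt_mul (by positivity)]
    refine Real.le_sqrt_of_sq_le ?_
    rw [h2]
    linarith
  -- `P` is the bounded extension of the closed operator `D R`
  let P : L2 →L[ℂ] L2 := dL.extendOfNorm (R : L2 →ₗ[ℂ] L2)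
  have hP : ∀ x, P (R x) = d x := fun x =>
    LinearMap.extendOfNorm_eq (f := dL) (e := (R : L2 →ₗ[ℂ] L2)) hdense ⟨_, hbound⟩ x
  have hRP : ∀ y, (R y, P y) ∈ derivGraph := by
    intro y
    refine hdense.induction_on (p := fun y => (R y, P y) ∈ derivGraph) y ?_ fun x => ?_
    · exact isClosed_derivGraph.preimage (R.continuous.prodMk P.continuous)
    · rw [hP]; exact hd x
  -- conversely `H¹ ⊆ ran R`: a function `v` in `H¹` satisfies `⟪v, x⟫ = ⟪v', P R x⟫ + ⟪v, V R² x⟫`,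
  -- and every `x` on the right-hand side stands behind a factor `R`
  have hsub : ∀ {v v' : L2}, (v, v') ∈ derivGraph →
      v = R (ContinuousLinearMap.adjoint P v' + R (V v)) := by
    intro v v' hv
    refine ext_inner_right ℂ fun x => ?_
    rw [inner_schrodingerOp hV hv (hd x) (hmem x), hsymm, inner_add_left,
      ContinuousLinearMap.adjoint_inner_left, hP, hsymm]
    congr 1
    exact (ContinuousLinearMap.isSelfAdjoint_iff_isSymmetric.mp
      (isSelfAdjoint_mulCLM_ofReal hV) v (R (R x))).symm
  refine ⟨ContinuousLinearMap.adjoint P ∘L (mulCLM hm ∘L P + mulCLM hm' ∘L R) +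
    R ∘L V ∘L mulCLM hm ∘L R, fun x => ?_⟩
  exact hsub (mul_mem_derivGraph hderiv hm hm' (hRP x))

end Schrodinger

/-! ### Comparison of norms and the Heinz inequality -/

section Heinz

variable {H : Type*} [NormedAddCommGroup H] [InnerProductSpace ℂ H] [CompleteSpace H]

theorem inner_apply_of_isSelfAdjoint {A : H →L[ℂ] H} (hA : IsSelfAdjoint A) (x y : H) :
    ⟪A x, y⟫_ℂ = ⟪x, A y⟫_ℂ :=
  ContinuousLinearMap.isSelfAdjoint_iff_isSymmetric.mp hA x y

theorem re_inner_apply_apply {A : H →L[ℂ] H} (hA : IsSelfAdjoint A) (x : H) :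
    (⟪A (A x), x⟫_ℂ).re = ‖A x‖ ^ 2 := by
  rw [inner_apply_of_isSelfAdjoint hA]
  exact inner_self_eq_norm_sq (𝕜 := ℂ) (A x)

/-- Loewner comparison of the squares of two selfadjoint operators. -/
theorem mul_self_le_smul_mul_self_iff {A B : H →L[ℂ] H} (hA : IsSelfAdjoint A)
    (hB : IsSelfAdjoint B) {c : ℝ} (hc : 0 ≤ c) :
    A * A ≤ (c • B) * (c • B) ↔ ∀ x, ‖A x‖ ≤ c * ‖B x‖ := by
  have hcB : IsSelfAdjoint (c • B) := IsSelfAdjoint.smul (by simp [IsSelfAdjoint]) hB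
  have h1 : ∀ x, ((c • B) * (c • B) - A * A).reApplyInnerSelf x =
      (c * ‖B x‖) ^ 2 - ‖A x‖ ^ 2 := by
    intro x
    rw [ContinuousLinearMap.reApplyInnerSelf_apply, sub_apply, inner_sub_left, map_sub]
    have h2 := re_inner_apply_apply hA x
    have h3 := re_inner_apply_apply hcB x
    have h4 : ‖(c • B) x‖ = c * ‖B x‖ := by
      rw [smul_apply, norm_smul, Real.norm_of_nonneg hc]
    rw [h4] at h3
    exact congrArg₂ (· - ·) h3 h2
  rw [ContinuousLinearMap.le_def, ContinuousLinearMap.isPositive_def]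
  constructor
  · rintro ⟨-, h⟩ x
    have h2 := h x
    rw [h1, sub_nonneg] at h2
    exact le_of_sq_le_sq h2 (by positivity)
  · intro h
    refine ⟨ContinuousLinearMap.isSelfAdjoint_iff_isSymmetric.mp ?_, fun x => ?_⟩
    · refine IsSelfAdjoint.sub ?_ ?_
      · exact IsSelfAdjoint.of_nonneg hcB.mul_self_nonneg
      · exact IsSelfAdjoint.of_nonneg hA.mul_self_nonneg
    · rw [h1, sub_nonneg]
      exact pow_le_pow_left₀ (norm_nonneg _) (h x) 2

/-- A case of the Heinz inequality, by monotonicity of the operator square root. -/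
theorem norm_apply_le_of_norm_sq_le {A B : H →L[ℂ] H} (hA : 0 ≤ A) (hB : 0 ≤ B) {c : ℝ}
    (hc : 0 ≤ c) (h : ∀ x, ‖A (A x)‖ ≤ c ^ 2 * ‖B (B x)‖) (x : H) : ‖A x‖ ≤ c * ‖B x‖ := by
  have hAs := IsSelfAdjoint.of_nonneg hA
  have hBs := IsSelfAdjoint.of_nonneg hB
  have hAA : 0 ≤ A * A := hAs.mul_self_nonneg
  have hcB : 0 ≤ c • B := smul_nonneg hc hB
  have hcBB : 0 ≤ (c • B) * (c • B) := (IsSelfAdjoint.of_nonneg hcB).mul_self_nonneg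
  have h1 : (c • B) * (c • B) = c ^ 2 • (B * B) := by
    rw [smul_mul_smul_comm, sq]
  have h2 := (mul_self_le_smul_mul_self_iff (IsSelfAdjoint.of_nonneg hAA)
    hBs.mul_self_nonneg.isSelfAdjoint (sq_nonneg c)).mpr h
  rw [← h1] at h2
  have h3 := CFC.sqrt_le_sqrt _ _ h2
  rw [CFC.sqrt_mul_self _ hAA, CFC.sqrt_mul_self _ hcBB] at h3
  exact (mul_self_le_smul_mul_self_iff hAs hBs hc).mp h3 x

theorem exists_nonneg_comp_self_eq {A : H →L[ℂ] H} (hA : 0 ≤ A) :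
    ∃ R : H →L[ℂ] H, 0 ≤ R ∧ R ∘L R = A :=
  ⟨CFC.sqrt A, CFC.sqrt_nonneg A, CFC.sqrt_mul_sqrt_self A hA⟩

theorem exists_norm_apply_le_of_pow_four {A B : H →L[ℂ] H} (hA : 0 ≤ A) (hB : 0 ≤ B) {c : ℝ}
    (hc : 0 ≤ c) (h : ∀ x, ‖A (A (A (A x)))‖ ≤ c * ‖B (B (B (B x)))‖) :
    ∃ C : ℝ, ∀ x, ‖A x‖ ≤ C * ‖B x‖ := by
  have h1 := norm_apply_le_of_norm_sq_le (IsSelfAdjoint.of_nonneg hA).mul_self_nonneg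
    (IsSelfAdjoint.of_nonneg hB).mul_self_nonneg (Real.sqrt_nonneg c)
    (fun x => by rw [Real.sq_sqrt hc]; exact h x)
  exact ⟨_, norm_apply_le_of_norm_sq_le hA hB (Real.sqrt_nonneg (Real.sqrt c))
    (fun x => by rw [Real.sq_sqrt (Real.sqrt_nonneg c)]; exact h1 x)⟩

/-- If `A = B J` with `A` and `B` selfadjoint, then also `A = J* B`. -/
theorem norm_apply_le_of_eq_comp {A B J : H →L[ℂ] H} (hA : IsSelfAdjoint A)
    (hB : IsSelfAdjoint B) (h : ∀ x, A x = B (J x)) (x : H) : ‖A x‖ ≤ ‖J‖ * ‖B x‖ := by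
  have h1 : A x = ContinuousLinearMap.adjoint J (B x) := by
    refine ext_inner_right ℂ fun y => ?_
    rw [inner_apply_of_isSelfAdjoint hA, h, ContinuousLinearMap.adjoint_inner_left,
      inner_apply_of_isSelfAdjoint hB]
  rw [h1, ← LinearIsometryEquiv.norm_map ContinuousLinearMap.adjoint J]
  exact ContinuousLinearMap.le_opNorm _ _

theorem norm_eq_of_pow_eight {K B : H →L[ℂ] H} (hK : IsSelfAdjoint K) (hB : IsSelfAdjoint B)
    (h : K ^ 8 = B ^ 2) (x : H) : ‖K (K (K (K x)))‖ = ‖B x‖ := by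
  have h1 : K ^ 8 = (K * K * K * K) * (K * K * K * K) := by noncomm_ring
  have h2 : (K * K * K * K) ((K * K * K * K) x) = B (B x) := by
    have := congrArg (fun A : H →L[ℂ] H => A x) h
    rw [h1, sq] at this
    exact this
  have h3 : IsSelfAdjoint (K * K * K * K) := by
    have : K * K * K * K = K ^ 4 := by noncomm_ring
    rw [this]; exact hK.pow 4
  have h4 := re_inner_apply_apply h3 x
  rw [h2, re_inner_apply_apply hB] at h4
  exact ((pow_left_inj₀ (norm_nonneg _) (norm_nonneg _) two_ne_zero).mp h4).symm

/-- Injective positive operators with comparable norms have the same range. -/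
theorem exists_equiv_of_norm_apply_le {R K : H →L[ℂ] H} (hR : IsSelfAdjoint R)
    (hK : IsSelfAdjoint K) (hRi : Function.Injective R) (hKi : Function.Injective K)
    (h₁ : ∃ c : ℝ, ∀ x, ‖R x‖ ≤ c * ‖K x‖) (h₂ : ∃ c : ℝ, ∀ x, ‖K x‖ ≤ c * ‖R x‖) :
    ∃ W : H ≃L[ℂ] H, ∀ x, R x = K (W x) := by
  have hKd := denseRange_of_isSelfAdjoint hK hKi
  have hRd := denseRange_of_isSelfAdjoint hR hRi
  -- the map `K x ↦ R x` extends to an isomorphism `Z`, and `R = Z K` has the adjoint `R = K Z*`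
  let Z : H ≃L[ℂ] H := LinearEquiv.extend (LinearEquiv.refl ℂ H) (K : H →ₗ[ℂ] H)
    (R : H →ₗ[ℂ] H) hKd h₁ hRd h₂
  have hZ : ∀ x, Z (K x) = R x := fun x =>
    LinearEquiv.extend_eq (LinearEquiv.refl ℂ H) (K : H →ₗ[ℂ] H) (R : H →ₗ[ℂ] H) hKd h₁ hRd h₂ x
  let Z₁ : H →L[ℂ] H := Z
  let Z₂ : H →L[ℂ] H := Z.symm
  refine ⟨ContinuousLinearEquiv.equivOfInverse (ContinuousLinearMap.adjoint Z₁)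
    (ContinuousLinearMap.adjoint Z₂) (fun x => ?_) (fun x => ?_), fun x => ?_⟩
  · refine ext_inner_right ℂ fun y => ?_
    rw [ContinuousLinearMap.adjoint_inner_left, ContinuousLinearMap.adjoint_inner_left]
    exact congrArg _ (Z.apply_symm_apply y)
  · refine ext_inner_right ℂ fun y => ?_
    rw [ContinuousLinearMap.adjoint_inner_left, ContinuousLinearMap.adjoint_inner_left]
    exact congrArg _ (Z.symm_apply_apply y)
  · refine ext_inner_right ℂ fun y => ?_
    change _ = ⟪K (ContinuousLinearMap.adjoint Z₁ x), y⟫_ℂ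
    rw [inner_apply_of_isSelfAdjoint hK, ContinuousLinearMap.adjoint_inner_left,
      inner_apply_of_isSelfAdjoint hR, ← hZ]
    rfl

end Heinz

/-! ### The resolvents of `D₂ D₁` and of `D₂^(1/2) D₁ D₂^(1/2)` -/

section Product

variable {H : Type*} [NormedAddCommGroup H] [InnerProductSpace ℂ H]

theorem isResolventAt_zero_iff {T : H →ₗ.[ℂ] H} {R : H →L[ℂ] H} :
    IsResolventAt T 0 R ↔ ∀ f g, (f, g) ∈ T.graph ↔ R g = f := by
  simp [IsResolventAt]

/-- A bounded injective operator is the inverse of an unbounded operator. -/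
theorem exists_isResolventAt_zero {R : H →L[ℂ] H} (hR : Function.Injective R) :
    ∃ S : H →ₗ.[ℂ] H, IsResolventAt S 0 R := by
  let G : Submodule ℂ (H × H) := LinearMap.eqLocus
    ((R : H →ₗ[ℂ] H) ∘ₗ LinearMap.snd ℂ H H) (LinearMap.fst ℂ H H)
  have hmem : ∀ f g, (f, g) ∈ G ↔ R g = f := fun f g => Iff.rfl
  refine ⟨G.toLinearPMap, isResolventAt_zero_iff.mpr fun f g => ?_⟩
  rw [Submodule.toLinearPMap_graph_eq, hmem]
  rintro ⟨f, g⟩ hp rfl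
  exact hR (((hmem _ _).mp hp).trans (map_zero R).symm)

theorem IsResolventAt.prodOp_zero {S : H →ₗ.[ℂ] H} {R : H →L[ℂ] H} (h : IsResolventAt S 0 R) :
    IsResolventAt (prodOp S S) 0 (R ∘L R) := by
  rw [isResolventAt_zero_iff] at h ⊢
  intro f g
  rw [mem_graph_prodOp]
  constructor
  · rintro ⟨y, h1, h2⟩
    rw [ContinuousLinearMap.comp_apply, (h _ _).mp h2, (h _ _).mp h1]
  · intro h1
    exact ⟨R g, (h _ _).mpr h1, (h _ _).mpr rfl⟩

theorem IsResolventAt.re_inner_nonneg {S : H →ₗ.[ℂ] H} {R : H →L[ℂ] H}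
    (h : IsResolventAt S 0 R) (hR : 0 ≤ R) (u : S.domain) : 0 ≤ (⟪S u, (u : H)⟫_ℂ).re := by
  have h1 := (isResolventAt_zero_iff.mp h _ _).mp (S.mem_graph u)
  rw [← h1]
  have h2 := ((ContinuousLinearMap.nonneg_iff_isPositive R).mp hR).re_inner_nonneg_right (S u)
  exact h2

variable [CompleteSpace H]

theorem mul_norm_sq_le_norm_add_sq {P : H →L[ℂ] H} (hP : IsSelfAdjoint P) (t : ℝ) (y : H) :
    2 * t * ‖P y‖ ^ 2 ≤ ‖y + (t : ℂ) • P (P y)‖ ^ 2 := by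
  have h1 := norm_add_sq (𝕜 := ℂ) y ((t : ℂ) • P (P y))
  have h2 : RCLike.re ⟪y, (t : ℂ) • P (P y)⟫_ℂ = t * ‖P y‖ ^ 2 := by
    rw [inner_smul_right, ← inner_apply_of_isSelfAdjoint hP, inner_self_eq_norm_sq_to_K]
    change ((t : ℂ) * ((‖P y‖ : ℝ) : ℂ) ^ 2).re = _
    rw [← Complex.ofReal_pow, ← Complex.ofReal_mul, Complex.ofReal_re]
  rw [h2] at h1
  have h3 := sq_nonneg ‖y‖
  have h4 := sq_nonneg ‖(t : ℂ) • P (P y)‖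
  linarith

theorem exists_inverse_one_add_mul_self {P : H →L[ℂ] H} (hP : IsSelfAdjoint P) {t : ℝ}
    (ht : 0 ≤ t) : ∃ C : H →L[ℂ] H, (∀ x, C (x + (t : ℂ) • P (P x)) = x) ∧
      ∀ x, C x + (t : ℂ) • P (P (C x)) = x := by
  have h1 : (1 : H →L[ℂ] H) ≤ 1 + t • (P * P) :=
    le_add_of_nonneg_right (smul_nonneg ht hP.mul_self_nonneg)
  obtain ⟨u, hu⟩ := CStarAlgebra.isUnit_of_le (1 : H →L[ℂ] H) h1
  have hQ : ∀ x, (u : H →L[ℂ] H) x = x + (t : ℂ) • P (P x) := fun x => by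
    rw [hu]; simp
  refine ⟨(u⁻¹ : (H →L[ℂ] H)ˣ), fun x => ?_, fun x => ?_⟩
  · rw [← hQ]
    exact congrArg (fun B : H →L[ℂ] H => B x) u.inv_mul
  · rw [← hQ]
    exact congrArg (fun B : H →L[ℂ] H => B x) u.mul_inv

/-- For large `t` the operator `1 + N P + t P²` is invertible, whatever the bounded operator `N`:
`t P²` dominates, in the sense that `P (1 + t P²)⁻¹` has norm at most `(2 t)^(-1/2)`. -/
theorem exists_inverse_one_add_comp_add {P : H →L[ℂ] H} (hP : IsSelfAdjoint P) (N : H →L[ℂ] H) :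
    ∃ (t : ℝ) (J : H →L[ℂ] H), (∀ x, J (x + N (P x) + (t : ℂ) • P (P x)) = x) ∧
      ∀ x, J x + N (P (J x)) + (t : ℂ) • P (P (J x)) = x := by
  let t : ℝ := ‖N‖ ^ 2 + 1
  have ht : 0 < t := by positivity
  obtain ⟨C, hC1, hC2⟩ := exists_inverse_one_add_mul_self hP ht.le
  have hn : ‖-(N ∘L P ∘L C)‖ < 1 := by
    have h1 : ‖P ∘L C‖ ≤ (Real.sqrt (2 * t))⁻¹ := by
      refine ContinuousLinearMap.opNorm_le_bound _ (by positivity) fun x => ?_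
      have h2 := mul_norm_sq_le_norm_add_sq hP t (C x)
      rw [hC2] at h2
      rw [inv_mul_eq_div, le_div_iff₀ (by positivity), mul_comm]
      refine le_of_sq_le_sq ?_ (norm_nonneg x)
      rw [mul_pow, Real.sq_sqrt (by positivity)]
      exact h2
    rw [norm_neg]
    calc ‖N ∘L P ∘L C‖ ≤ ‖N‖ * (Real.sqrt (2 * t))⁻¹ :=
          (ContinuousLinearMap.opNorm_comp_le _ _).trans
            (mul_le_mul_of_nonneg_left h1 (norm_nonneg _))
      _ < 1 := by
          rw [← div_eq_mul_inv, div_lt_one (by positivity)]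
          refine Real.lt_sqrt_of_sq_lt ?_
          have := sq_nonneg ‖N‖
          simp only [t]
          linarith
  obtain ⟨U, hU1, hU2⟩ := exists_inverse_one_sub hn
  have hU : ∀ x, x - (-(N ∘L P ∘L C)) x = x + N (P (C x)) := fun x => by simp
  refine ⟨t, C ∘L U, fun x => ?_, fun x => ?_⟩
  · have h1 : x + N (P x) + (t : ℂ) • P (P x) =
        (x + (t : ℂ) • P (P x)) - (-(N ∘L P ∘L C)) (x + (t : ℂ) • P (P x)) := by
      rw [hU, hC1]; abel
    rw [ContinuousLinearMap.comp_apply, h1, hU1, hC1]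
  · have h1 := hU2 x
    rw [hU] at h1
    have h2 := hC2 (U x)
    rw [ContinuousLinearMap.comp_apply]
    calc _ = (C (U x) + (t : ℂ) • P (P (C (U x)))) + N (P (C (U x))) := by abel
      _ = x := by rw [h2, h1]

/-- The resolvent `B` of the symmetric product `Λ = R⁻¹ D₁ R⁻¹`, where `D₁ = R⁻² + M`, at a suitable
point `-t`. It is `R⁴ J⁻¹` with `J = 1 + N R² + t R⁴`, and it is comparable to `R⁴`. -/
theorem exists_product_resolvent {R M N : H →L[ℂ] H} (hR : IsSelfAdjoint R)
    (hinj : Function.Injective R) (hM : IsSelfAdjoint M) (hMN : ∀ x, M (R x) = R (N x)) :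
    ∃ (t : ℝ) (B : H →L[ℂ] H), IsSelfAdjoint B ∧ Function.Injective B ∧
      (∃ c : ℝ, 0 ≤ c ∧ ∀ x, ‖R (R (R (R x)))‖ ≤ c * ‖B x‖) ∧
      (∃ c : ℝ, 0 ≤ c ∧ ∀ x, ‖B x‖ ≤ c * ‖R (R (R (R x)))‖) ∧
      ∀ u g, B (g + (t : ℂ) • u) = u ↔ ∃ v, R v = u ∧ R (R (R g - M v)) = v := by
  have hRR : IsSelfAdjoint (R ∘L R) := hR.mul_self_nonneg.isSelfAdjoint
  have hR4 : IsSelfAdjoint (R ∘L R ∘L R ∘L R) := hRR.mul_self_nonneg.isSelfAdjoint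
  obtain ⟨t, U, hU1, hU2⟩ := exists_inverse_one_add_comp_add hRR N
  simp only [ContinuousLinearMap.comp_apply] at hU1 hU2
  let J : H →L[ℂ] H := 1 + N ∘L R ∘L R + (t : ℂ) • (R ∘L R ∘L R ∘L R)
  have hJ : ∀ x, J x = x + N (R (R x)) + (t : ℂ) • R (R (R (R x))) := fun x => rfl
  let B : H →L[ℂ] H := R ∘L R ∘L R ∘L R ∘L U
  have hBJ : ∀ x, B (J x) = R (R (R (R x))) := fun x => by
    change R (R (R (R (U (J x))))) = _
    rw [hJ, hU1]
  have hJU : ∀ x, J (U x) = x := fun x => by rw [hJ, hU2]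
  have hs := inner_apply_of_isSelfAdjoint hR
  have hB : IsSelfAdjoint B := by
    rw [ContinuousLinearMap.isSelfAdjoint_iff_isSymmetric]
    intro x y
    change ⟪B x, y⟫_ℂ = ⟪x, B y⟫_ℂ
    rw [← hJU x, ← hJU y, hBJ, hBJ, hJ, hJ]
    simp only [inner_add_left, inner_add_right, inner_smul_left, inner_smul_right,
      Complex.conj_ofReal]
    -- the middle terms agree since `R N R² = M R³` and `M` is symmetric
    congr 2
    · rw [hs, hs, hs, hs]
    · rw [hs, ← hMN, ← inner_apply_of_isSelfAdjoint hM, hMN, hs]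
  refine ⟨t, B, hB, fun x y hxy => ?_, ⟨‖J‖, norm_nonneg _, fun x => ?_⟩,
    ⟨‖U‖, norm_nonneg _, fun x => ?_⟩, fun u g => ?_⟩
  · have h1 : U x = U y := hinj (hinj (hinj (hinj hxy)))
    rw [← hJU x, h1, hJU]
  · exact norm_apply_le_of_eq_comp hR4 hB (fun x => (hBJ x).symm) x
  · exact norm_apply_le_of_eq_comp hB hR4 (fun x => rfl) x
  · constructor
    · -- `u = R⁴ z` with `J z = g + t u`, hence `g = z + N R² z`; the vector `v` is `R³ z`
      intro h
      let z := U (g + (t : ℂ) • u)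
      have hu : R (R (R (R z))) = u := h
      have hz : z + N (R (R z)) + (t : ℂ) • R (R (R (R z))) = g + (t : ℂ) • u := hU2 _
      rw [hu] at hz
      have hg : g = z + N (R (R z)) := (add_right_cancel hz).symm
      refine ⟨R (R (R z)), hu, ?_⟩
      rw [hg, map_add, hMN, add_sub_cancel_right]
    · -- with `v = R² y` one has `M v = R N R y`, hence `y = R (g - N R y)`
      rintro ⟨v, rfl, hv⟩
      let y := R g - M v
      have hv' : v = R (R y) := hv.symm
      let z := g - N (R y)
      have hy : y = R z := by
        simp only [z, map_sub, ← hMN, ← hv']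
        rfl
      have hg : g + (t : ℂ) • R v = J z := by
        rw [hJ, hv', hy, ← hy]
        simp only [z]
        abel
      rw [hg, hBJ, hv', hy]

/-- Let `D₂ = R⁻²` with `R` positive and `D₁ = D₂ + M`, and let `M` leave the form domain `ran R` of
`D₂` invariant. Then `Λ = S D₁ S`, where `S = R⁻¹`, has a Borel calculus `F`, and `D₂ D₁` is similar
to `Λ` by a bounded operator `V` with bounded inverse. The operator `R V`, which is the
fourth root of `|(Λ + t)⁻¹|`, commutes with the calculus. -/
theorem exists_calculus_prodOp {D₁ D₂ S : H →ₗ.[ℂ] H} {R M N : H →L[ℂ] H} (hR : 0 ≤ R)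
    (hS : IsResolventAt S 0 R) (hD₂ : IsResolventAt D₂ 0 (R ∘L R))
    (hD₁ : ∀ f g, (f, g) ∈ D₁.graph ↔ (f, g - M f) ∈ D₂.graph)
    (hM : IsSelfAdjoint M) (hMN : ∀ x, M (R x) = R (N x)) :
    ∃ (t : ℝ) (B : H →L[ℂ] H) (F : (ℝ → ℂ) → H →L[ℂ] H) (V : H ≃L[ℂ] H),
      IsSelfAdjoint B ∧ (∀ b, IsSelfAdjoint (calcMeasure F b)) ∧
      IsOperatorCalculus F (prodOp S (prodOp D₁ S)) t B ∧
      IsResolventAt (prodOp D₂ D₁) t ((V : H →L[ℂ] H) ∘L B ∘L (V.symm : H →L[ℂ] H)) ∧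
      ∀ φ, IsBddMeas φ → ∀ x, F φ (R x) = R (V (F φ (V.symm x))) := by
  have hRs := IsSelfAdjoint.of_nonneg hR
  have hinj := hS.injective
  obtain ⟨t, B, hB, hBi, ⟨c₁, hc₁, h₁⟩, ⟨c₂, hc₂, h₂⟩, hiff⟩ :=
    exists_product_resolvent hRs hinj hM hMN
  obtain ⟨F, K, hF, hFs, hK, hK8, hKB, hKF⟩ := exists_isOperatorCalculus hB hBi t
  have hKs := IsSelfAdjoint.of_nonneg hK
  have hK4 := norm_eq_of_pow_eight hKs hB hK8
  have hKi : Function.Injective K := by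
    rw [injective_iff_map_eq_zero]
    intro x hx
    have h3 := hK4 x
    rw [hx, map_zero, map_zero, map_zero, norm_zero] at h3
    exact hBi ((norm_eq_zero.mp h3.symm).trans (map_zero B).symm)
  obtain ⟨W, hW⟩ := exists_equiv_of_norm_apply_le hRs hKs hinj hKi
    (exists_norm_apply_le_of_pow_four hR hK hc₁ fun x => by rw [hK4]; exact h₁ x)
    (exists_norm_apply_le_of_pow_four hK hR hc₂ fun x => by rw [hK4]; exact h₂ x)
  rw [isResolventAt_zero_iff] at hS hD₂
  refine ⟨t, B, F, W.symm, hB, hFs, hF _ fun u g => ?_, fun f g => ?_, fun φ hφ x => ?_⟩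
  · -- `(u, g) ∈ Λ` means `u = R v` with `(v, R g) ∈ D₁`
    rw [hiff, mem_graph_prodOp]
    constructor
    · rintro ⟨y, h3, h4⟩
      obtain ⟨v, h5, h6⟩ := mem_graph_prodOp.mp h3
      rw [hS] at h4 h5
      rw [hD₁, hD₂, ← h4] at h6
      exact ⟨v, h5, h6⟩
    · rintro ⟨v, h5, h6⟩
      exact ⟨R g, mem_graph_prodOp.mpr ⟨v, (hS _ _).mpr h5, (hD₁ _ _).mpr ((hD₂ _ _).mpr h6)⟩,
        (hS _ _).mpr rfl⟩
  · have h3 : (f, g) ∈ (prodOp D₂ D₁).graph ↔ R (R (R (R g) - M f)) = f := by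
      rw [mem_graph_prodOp]
      constructor
      · rintro ⟨y, h4, h5⟩
        rw [hD₂] at h5
        rw [hD₁, hD₂, ← h5] at h4
        exact h4
      · intro h4
        exact ⟨R (R g), (hD₁ _ _).mpr ((hD₂ _ _).mpr h4), (hD₂ _ _).mpr rfl⟩
    have h4 : B (R g + (t : ℂ) • R f) = R f ↔ R (R (R (R g) - M f)) = f := by
      rw [hiff]
      constructor
      · rintro ⟨v, h5, h6⟩
        rwa [hinj h5] at h6
      · exact fun h6 => ⟨f, rfl, h6⟩
    -- with `R = K W` the factor `K`, which commutes with `B`, cancels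
    rw [h3, ← h4, ← map_smul, ← map_add, hW, hW, ← hKB, hKi.eq_iff]
    exact (W.symm_apply_eq).symm
  · rw [hW, hW, ← hKF φ hφ]
    simp

/-- Spectral calculus for the adjoint of an operator that is similar to a selfadjoint one. -/
theorem IsOperatorCalculus.adjoint_conj {Λ T : H →ₗ.[ℂ] H} {F : (ℝ → ℂ) → H →L[ℂ] H} {t : ℝ}
    {B : H →L[ℂ] H} (hF : IsOperatorCalculus F Λ t B) (hB : IsSelfAdjoint B)
    (hFs : ∀ b, IsSelfAdjoint (calcMeasure F b)) (V : H ≃L[ℂ] H)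
    (hT : IsResolventAt T t ((V : H →L[ℂ] H) ∘L B ∘L (V.symm : H →L[ℂ] H)))
    (hd : Dense (T.domain : Set H)) :
    ∃ (F' : (ℝ → ℂ) → H →L[ℂ] H) (B' : H →L[ℂ] H), IsOperatorCalculus F' T† t B' ∧
      calcMeasure F' = fun b => ContinuousLinearMap.adjoint
        (calcMeasure (fun φ => (V : H →L[ℂ] H) ∘L F φ ∘L (V.symm : H →L[ℂ] H)) b) := by
  let V₁ : H →L[ℂ] H := V
  let V₂ : H →L[ℂ] H := V.symm
  let V' : H ≃L[ℂ] H := ContinuousLinearEquiv.equivOfInverse (ContinuousLinearMap.adjoint V₂)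
    (ContinuousLinearMap.adjoint V₁)
    (fun x => ext_inner_right ℂ fun y => by
      rw [ContinuousLinearMap.adjoint_inner_left, ContinuousLinearMap.adjoint_inner_left]
      exact congrArg _ (V.symm_apply_apply y))
    (fun x => ext_inner_right ℂ fun y => by
      rw [ContinuousLinearMap.adjoint_inner_left, ContinuousLinearMap.adjoint_inner_left]
      exact congrArg _ (V.apply_symm_apply y))
  have hconj : ∀ A : H →L[ℂ] H, IsSelfAdjoint A →
      ContinuousLinearMap.adjoint (V₁ ∘L A ∘L V₂) =
        (V' : H →L[ℂ] H) ∘L A ∘L (V'.symm : H →L[ℂ] H) := by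
    intro A hA
    rw [ContinuousLinearMap.adjoint_comp, ContinuousLinearMap.adjoint_comp,
      ContinuousLinearMap.isSelfAdjoint_iff'.mp hA]
    rfl
  have h1 := hT.adjoint hd
  have h2 := hconj B hB
  simp only [V₁, V₂] at h2
  rw [h2] at h1
  exact ⟨_, _, hF.conj V' h1, funext fun b => (hconj _ (hFs b)).symm⟩

end Product

/-! ### Two Schrödinger operators -/

section TwoOperators

theorem isBddMeas_ofReal {f : ℝ → ℝ} (hf : Measurable f) (hb : ∃ c : ℝ, ∀ x, |f x| ≤ c) :
    IsBddMeas fun x => (f x : ℂ) := by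
  obtain ⟨c, hc⟩ := hb
  exact ⟨Complex.measurable_ofReal.comp hf, c, fun x => by
    rw [Complex.norm_real]; exact hc x⟩

theorem IsAdmissible.isBddMeas {q : ℝ → ℝ} (hq : IsAdmissible q) :
    IsBddMeas fun x => (q x : ℂ) :=
  isBddMeas_ofReal hq.contDiff.continuous.measurable hq.exists_abs_le

theorem IsAdmissible.isBddMeas_deriv {q : ℝ → ℝ} (hq : IsAdmissible q) :
    IsBddMeas fun x => ((deriv q x : ℝ) : ℂ) :=
  isBddMeas_ofReal (measurable_deriv q) hq.exists_abs_deriv_le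

theorem IsAdmissible.isBddMeas_add {q : ℝ → ℝ} (hq : IsAdmissible q) (h : ℝ) :
    IsBddMeas fun x => ((q x + h : ℝ) : ℂ) := by
  have := hq.isBddMeas.add (isBddMeas_const (h : ℂ))
  simpa [Pi.add_def] using this

theorem mulCLM_eq_add {a b c : ℝ → ℂ} (ha : IsBddMeas a) (hb : IsBddMeas b) (hc : IsBddMeas c)
    (h : ∀ x, a x = b x + c x) (u : L2) : mulCLM ha u = mulCLM hb u + mulCLM hc u := by
  refine Lp.ext ?_
  filter_upwards [coeFn_mulCLM ha u, coeFn_mulCLM hb u, coeFn_mulCLM hc u,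
    Lp.coeFn_add (mulCLM hb u) (mulCLM hc u)] with x h1 h2 h3 h4
  rw [h4, Pi.add_apply, h1, h2, h3, h x, add_mul]

/-- On the graphs, `D₁ = D₂ + M` with the multiplication `M` by `q₁ - q₂ + h₁ - h₂`. -/
theorem mem_graph_schrodingerOp_iff_sub {h₁ h₂ : ℝ} {q₁ q₂ : ℝ → ℝ}
    (hV₁ : IsBddMeas fun x => ((q₁ x + h₁ : ℝ) : ℂ))
    (hV₂ : IsBddMeas fun x => ((q₂ x + h₂ : ℝ) : ℂ))
    (hm : IsBddMeas fun x => ((q₁ x - q₂ x + (h₁ - h₂) : ℝ) : ℂ)) (f g : L2) :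
    (f, g) ∈ (schrodingerOp h₁ q₁).graph ↔
      (f, g - mulCLM hm f) ∈ (schrodingerOp h₂ q₂).graph := by
  have h := mulCLM_eq_add hV₁ hV₂ hm (fun x => by push_cast; ring) f
  rw [mem_graph_schrodingerOp hV₁, mem_graph_schrodingerOp hV₂]
  simp only [h, sub_eq_iff_eq_add, add_assoc]

end TwoOperators

end SpectralODE

end

theorem mainTheorem2 (h₁ h₂ : ℝ) (q₁ q₂ : ℝ → ℝ) (hh₁ : 0 < h₁) (hh₁₂ : h₁ < h₂)
    (hq₁ : SpectralODE.IsAdmissible q₁) (hq₂ : SpectralODE.IsAdmissible q₂)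
    (D₁ D₂ L : SpectralODE.L2 →ₗ.[ℂ] SpectralODE.L2)
    (hD₁ : D₁ = SpectralODE.schrodingerOp h₁ q₁) (hD₂ : D₂ = SpectralODE.schrodingerOp h₂ q₂)
    (hL : L = SpectralODE.prodOp D₂ D₁)
    (c₂ : ℝ) (hc₂ : 0 < c₂)
    (hpos : ∀ u : D₂.domain, c₂ * ‖(u : SpectralODE.L2)‖ ^ 2 ≤
      (⟪D₂ u, (u : SpectralODE.L2)⟫_ℂ).re) :
    ∃ (S : SpectralODE.L2 →ₗ.[ℂ] SpectralODE.L2)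
      (EΛ E : Set ℝ → SpectralODE.L2 →L[ℂ] SpectralODE.L2),
      -- `S` is the positive square root of `D₂` and `EΛ` is the resolution of the identity of
      -- the selfadjoint operator `Λ = S D₁ S`
      SpectralODE.IsPositiveSqrt S D₂ ∧
      SpectralODE.IsSelfAdjointResolution (SpectralODE.prodOp S (SpectralODE.prodOp D₁ S)) EΛ ∧
      -- `E b = S (EΛ b) S⁻¹` for bounded Borel sets `b`
      LinearMap.range S.toFun = ⊤ ∧
      (∀ b, MeasurableSet b → Bornology.IsBounded b → ∀ g : S.domain,
        ∃ h : EΛ b g ∈ S.domain, E b (S g) = S ⟨EΛ b g, h⟩) ∧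
      -- the limit formula, and the scalar type property, for `L` and its adjoint
      SpectralODE.HasSpectralLimit L E ∧
      SpectralODE.IsScalarSpectral L (SpectralODE.onReals E) ∧
      SpectralODE.HasSpectralLimit L† (fun b => ContinuousLinearMap.adjoint (E b)) ∧
      SpectralODE.IsScalarSpectral L†
        (SpectralODE.onReals (fun b => ContinuousLinearMap.adjoint (E b))) := by
  open SpectralODE in
  subst hD₁ hD₂ hL
  have hV₁ := hq₁.isBddMeas_add h₁
  have hV₂ := hq₂.isBddMeas_add h₂
  have hm : IsBddMeas fun x => ((q₁ x - q₂ x + (h₁ - h₂) : ℝ) : ℂ) := by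
    have := hV₁.sub hV₂
    refine (congrArg IsBddMeas (funext fun x => ?_)).mp this
    rw [Pi.sub_apply]
    push_cast
    ring
  have hm' : IsBddMeas fun x => ((deriv q₁ x - deriv q₂ x : ℝ) : ℂ) := by
    simpa [Pi.sub_def] using hq₁.isBddMeas_deriv.sub hq₂.isBddMeas_deriv
  have hd : ∀ x, HasDerivAt (fun x => q₁ x - q₂ x + (h₁ - h₂)) (deriv q₁ x - deriv q₂ x) x :=
    fun x => ((hq₁.contDiff.differentiable one_ne_zero x).hasDerivAt.sub
      (hq₂.contDiff.differentiable one_ne_zero x).hasDerivAt).add_const _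
  obtain ⟨A, hA, hA0⟩ := exists_inverse_schrodingerOp hV₂ hc₂ fun f g hfg => by
    obtain ⟨h, rfl⟩ := mem_graph_iff_exists.mp hfg
    exact hpos ⟨f, h⟩
  obtain ⟨R, hR, rfl⟩ := exists_nonneg_comp_self_eq hA0
  have hRs : IsSelfAdjoint R := ((ContinuousLinearMap.nonneg_iff_isPositive R).mp hR).isSelfAdjoint
  have hinj : Function.Injective R := Function.Injective.of_comp (f := R) hA.injective
  obtain ⟨S, hS⟩ := exists_isResolventAt_zero hinj
  have hS' := isResolventAt_zero_iff.mp hS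
  obtain ⟨N, hN⟩ := exists_mulCLM_sqrt_eq hV₂ hRs hA hd hm hm'
  obtain ⟨t, B, F, V, hB, hFs, hF, hT, hFV⟩ := exists_calculus_prodOp hR hS hA
    (mem_graph_schrodingerOp_iff_sub hV₁ hV₂ hm) (isSelfAdjoint_mulCLM_ofReal hm) hN
  have hG := hF.conj V hT
  obtain ⟨F', B', hF', hE'⟩ := hF.adjoint_conj hB hFs V hT hG.isScalarSpectral.dense_domain
  refine ⟨S, calcMeasure F, calcMeasure _, ⟨?_, hS.re_inner_nonneg hR, hS.prodOp_zero.eq hA⟩,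
    ⟨hF.resolvent.isSelfAdjoint hF.isScalarSpectral.dense_domain hB, fun b _ => hFs b,
      hF.isScalarSpectral⟩, ?_, ?_, hG.hasSpectralLimit, hG.isScalarSpectral,
    hE' ▸ hF'.hasSpectralLimit, hE' ▸ hF'.isScalarSpectral⟩
  · exact hS.isSelfAdjoint (hS.dense_domain (denseRange_of_isSelfAdjoint hRs hinj)) hRs
  · rw [LinearMap.range_eq_top]
    intro y
    obtain ⟨h, hy⟩ := mem_graph_iff_exists.mp ((hS' (R y) y).mpr rfl)
    exact ⟨⟨R y, h⟩, hy⟩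
  · intro b hb _ g
    have hg : R (S g) = g := (hS' _ _).mp (S.mem_graph g)
    have h1 := hFV _ (isBddMeas_indicator_one hb) (S g)
    rw [hg] at h1
    obtain ⟨h, h2⟩ := mem_graph_iff_exists.mp ((hS' _ _).mpr h1.symm)
    exact ⟨h, h2.symm⟩
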